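/- **Setting.** There are $k\ge 1$ players and a coordinator with a threshold $N$. Items arrive one at a time; independently of the others, each item arrives at player $i$ with probability $\mu_i$, where $\sum_{i=1}^k\mu_i=1$ and the $\mu_i$ are unknown to the algorithms. Let $0<\delta<1$ with $k/\delta\ge 2$ (automatic if $k\ge 2$). The communication cost is the total number of messages sent and received by the coordinator. **Rounds.** In a round with threshold $N$ the coordinator sends each player its slack ($k$ messages) and the counters $n_i$ start at $0$; at the $\ell$-th notification the coordinator collects all counters ($2k$ messages) and replaces $N$ by $N-\sum_i n_i$; it stops if nothing is left, and otherwise starts a new round. Thus a round costs $3k+\ell$ messages. The straightforward algorithm costs $k+N$ messages (one to each player, and one for each item). A CMY round has $\ell=k$, and every player notifies each time its counter has grown by $s=\lfloor N/(2k)\rfloor$. The CMY algorithm plays CMY rounds while $N\ge 4k$ and runs the straightforward algorithm as soon as $N<4k$. **The two learning algorithms.** Put $\beta=2\,(2\sqrt2+\tfrac23+3)^2$. At the start of each round: if $N\le 4k$, run the straightforward algorithm to the end; otherwise, if $N\le\beta k\ln\frac k\delta$, run the CMY algorithm to the end; otherwise play one round. The first round is a CMY round. If $w$ items have arrived in it,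 $n_i$ of them at player $i$, put $\bar\mu_i=n_i/w$, $$\hat\mu_i=\bar\mu_i+\sqrt{\frac{2(\bar\mu_i-\bar\mu_i^2)\ln\frac3\delta}{w}}+\frac{3\ln\frac3\delta}{w},\qquad \hat\Sigma=\sum_{i=1}^k\hat\mu_i .$$ In each later round, with current threshold $N$, put $$t=\frac N{\hat\Sigma}-\Bigl(\sqrt2+\frac23\Bigr)\sqrt{k\,\frac N{\hat\Sigma}\ln\frac k\delta}.$$ * *StcSlk-LrnDst*: $\ell=1$, and player $i$ notifies when $n_i$ reaches $s_i=\hat\mu_i t+\sqrt{2t\hat\mu_i\ln\frac k\delta}+\frac23\ln\frac k\delta$. * *DynSlk-LrnDst*: $\ell=k$, and player $i$ notifies each time its counter has grown by $\lfloor (N-t)/(2k)\rfloor$ beyond the base value $b_i=\hat\mu_i t$. **Theorem.** There is an absolute constant $C>0$ such that, for all $k$, $N$, $\delta$ and $(\mu_i)$ as above, each of the two algorithms StcSlk-LrnDst and DynSlk-LrnDst, run with threshold $N$ and parameter $\delta$, terminates with probability at least $1-\delta$ with communication cost at most $$C\Bigl(k\,\log\log\frac{N}{k\ln\frac k\delta}+k\,\log\log\frac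 k\delta\Bigr),$$ where $\log\log x$ is read as $1$ where it is undefined or less than $1$. -/

import Mathlib

namespace DistTracking

noncomputable section

/-- The counters of the players in a round that starts after the first `p` items of the stream `a`,
at the moment when `m` items of the round have arrived (`a j` is the player that receives the
`j`-th item, counted from `0`). -/
def counter {k : ℕ} (a : ℕ → Fin k) (p m : ℕ) (i : Fin k) : ℕ :=
  ((Finset.range m).filter fun j => a (p + j) = i).card

/-- The characteristics of a round of an `ℓ`-Notifications-to-End algorithm: `sent i n` is the
number of notifications that player `i` has sent when its counter has reached `n`, and `ell` is the
number of notifications at which the coordinator ends the round. -/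
structure RoundRule (k : ℕ) where
  sent : Fin k → ℕ → ℕ
  ell : ℕ

/-- The `ell`-th notification is sent on the arrival of the `m`-th item of the round. -/
def RoundRule.EndsAt {k : ℕ} (R : RoundRule k) (a : ℕ → Fin k) (p m : ℕ) : Prop :=
  IsLeast {m' : ℕ | R.ell ≤ ∑ i, R.sent i (counter a p m' i)} m

/-- Messages of one round: `k` slack messages, `ell` notifications, `k` requests for the counters
and `k` answers. -/
def RoundRule.cost {k : ℕ} (R : RoundRule k) : ℕ := k + R.ell + k + k

/-- A CMY round with threshold `N`: slack `⌊N / (2k)⌋` for everybody, one notification for each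
increase of the counter by the slack, `k` notifications to end. -/
def cmyRule (k N : ℕ) : RoundRule k where
  sent _ n := n / (N / (2 * k))
  ell := k

/-- A round with static slacks `s i`: player `i` notifies once, when its counter reaches `s i`; the
first notification ends the round. -/
def staticRule {k : ℕ} (s : Fin k → ℝ) : RoundRule k where
  sent i n := if s i ≤ (n : ℝ) then 1 else 0
  ell := 1

/-- A round with dynamic slacks: player `i` notifies for each increase of its counter by `s` beyond
the base value `b i`; `k` notifications end the round. -/
def dynamicRule {k : ℕ} (b : Fin k → ℝ) (s : ℕ) : RoundRule k where
  sent i n := ⌊((n : ℝ) - b i) / (s : ℝ)⌋₊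
  ell := k

/-- Messages of the straightforward algorithm with threshold `N`: one message to each player to
start it, then one message per item. -/
def directCost (k N : ℕ) : ℕ := k + N

/-- `CMYRun a p N c`: the CMY algorithm, started after the first `p` items of the stream `a` with
threshold `N`, terminates and uses `c` messages in total. -/
inductive CMYRun {k : ℕ} (a : ℕ → Fin k) : ℕ → ℕ → ℕ → Prop
  | alarm (p : ℕ) : CMYRun a p 0 0
  | direct (p N : ℕ) (h0 : 0 < N) (h : N < 4 * k) : CMYRun a p N (directCost k N)
  | round (p N m c : ℕ) (h : 4 * k ≤ N) (hm : (cmyRule k N).EndsAt a p m)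
      (hc : CMYRun a (p + m) (N - m) c) : CMYRun a p N ((cmyRule k N).cost + c)

/-- `FrameworkRun β δ rule a p N c`: the `ℓ`-Notifications-to-End framework with switching
constant `β` and failure parameter `δ`, where a round with threshold `N` is played by `rule N`,
started after the first `p` items of `a` with threshold `N`, terminates and uses `c` messages. -/
inductive FrameworkRun {k : ℕ} (β δ : ℝ) (rule : ℕ → RoundRule k) (a : ℕ → Fin k) :
    ℕ → ℕ → ℕ → Prop
  | alarm (p : ℕ) : FrameworkRun β δ rule a p 0 0
  | direct (p N : ℕ) (h0 : 0 < N) (h : N ≤ 4 * k) :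
      FrameworkRun β δ rule a p N (directCost k N)
  | cmy (p N c : ℕ) (h : 4 * k < N) (hβ : (N : ℝ) ≤ β * (k * Real.log (k / δ)))
      (hc : CMYRun a p N c) : FrameworkRun β δ rule a p N c
  | round (p N m c : ℕ) (h : 4 * k < N) (hβ : β * (k * Real.log (k / δ)) < (N : ℝ))
      (hm : (rule N).EndsAt a p m) (hc : FrameworkRun β δ rule a (p + m) (N - m) c) :
      FrameworkRun β δ rule a p N ((rule N).cost + c)

/-- `LearningRun β δ learn a N c`: the same framework with threshold `N`, but the first round is a
CMY round, and the rule for all later rounds is `learn n`, where `n` are the counters collected at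
the end of the first round. -/
inductive LearningRun {k : ℕ} (β δ : ℝ) (learn : (Fin k → ℕ) → ℕ → RoundRule k)
    (a : ℕ → Fin k) : ℕ → ℕ → Prop
  | alarm : LearningRun β δ learn a 0 0
  | direct (N : ℕ) (h0 : 0 < N) (h : N ≤ 4 * k) : LearningRun β δ learn a N (directCost k N)
  | cmy (N c : ℕ) (h : 4 * k < N) (hβ : (N : ℝ) ≤ β * (k * Real.log (k / δ)))
      (hc : CMYRun a 0 N c) : LearningRun β δ learn a N c
  | learnRound (N w c : ℕ) (h : 4 * k < N) (hβ : β * (k * Real.log (k / δ)) < (N : ℝ))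
      (hw : (cmyRule k N).EndsAt a 0 w)
      (hc : FrameworkRun β δ (learn (counter a 0 w)) a w (N - w) c) :
      LearningRun β δ learn a N ((cmyRule k N).cost + c)

/-- The number `w` of items of the first round, from the collected counters. -/
def total {k : ℕ} (n : Fin k → ℕ) : ℝ := ∑ i, (n i : ℝ)

/-- The empirical frequency of player `i`. -/
def muBar {k : ℕ} (n : Fin k → ℕ) (i : Fin k) : ℝ := (n i : ℝ) / total n

/-- The upper-confidence estimate of the probability of player `i`. -/
def muHat {k : ℕ} (δ : ℝ) (n : Fin k → ℕ) (i : Fin k) : ℝ :=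
  muBar n i + √(2 * (muBar n i - muBar n i ^ 2) * Real.log (3 / δ) / total n)
    + 3 * Real.log (3 / δ) / total n

def sigmaHat {k : ℕ} (δ : ℝ) (n : Fin k → ℕ) : ℝ := ∑ i, muHat δ n i

/-- The number `t` of items that a round with threshold `N` aims at. -/
def target {k : ℕ} (δ : ℝ) (n : Fin k → ℕ) (N : ℕ) : ℝ :=
  N / sigmaHat δ n - (√2 + 2 / 3) * √(k * (N / sigmaHat δ n) * Real.log (k / δ))

/-- The modified static slack `UB_i`. -/
def upperBound {k : ℕ} (δ : ℝ) (n : Fin k → ℕ) (N : ℕ) (i : Fin k) : ℝ :=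
  muHat δ n i * target δ n N + √(2 * target δ n N * muHat δ n i * Real.log (k / δ))
    + 2 / 3 * Real.log (k / δ)

def learnedStaticRule {k : ℕ} (δ : ℝ) (n : Fin k → ℕ) (N : ℕ) : RoundRule k :=
  staticRule (upperBound δ n N)

def learnedDynamicRule {k : ℕ} (δ : ℝ) (n : Fin k → ℕ) (N : ℕ) : RoundRule k :=
  dynamicRule (fun i => muHat δ n i * target δ n N) ⌊((N : ℝ) - target δ n N) / (2 * k)⌋₊

/-- The constant of the switch to CMY in the learning based algorithms. -/
def learnBeta : ℝ := 2 * (2 * √2 + 2 / 3 + 3) ^ 2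

/-- On the stream `a` with threshold `N`, the algorithm StcSlk-LrnDst with failure parameter `δ`
terminates and its communication cost is `c` messages. -/
def StcSlkLrnDst {k : ℕ} (δ : ℝ) (a : ℕ → Fin k) (N c : ℕ) : Prop :=
  LearningRun learnBeta δ (learnedStaticRule δ) a N c

/-- On the stream `a` with threshold `N`, the algorithm DynSlk-LrnDst with failure parameter `δ`
terminates and its communication cost is `c` messages. -/
def DynSlkLrnDst {k : ℕ} (δ : ℝ) (a : ℕ → Fin k) (N c : ℕ) : Prop :=
  LearningRun learnBeta δ (learnedDynamicRule δ) a N c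

/-- `log log x`, replaced by `1` where it is smaller than `1` or undefined. -/
def loglog (x : ℝ) : ℝ := Real.log (max (Real.exp 1) (Real.log x))

end

end DistTracking

/-!
A round of a learning algorithm fails if the coordinator is notified too early. Bernstein's
inequality for every player (with a static slack), or Hoeffding's inequality for every set of
players (with a dynamic slack), bounds the probability of a failure by `0.99 δ`. By the strong
Markov property this bound also holds conditionally on the past, so that the failures of `r` rounds
behave as if they were independent.

Let `K = k log (k / δ)`, let `N₀` be the initial threshold and `x = N / K`. A round that does not
fail either collects a constant fraction of the current threshold `N`, or leaves a threshold of
order `√(K N) + √(N / N₀) N`, where the second term comes from the errors of the estimates `μ̂ᵢ`. If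
the first term dominates, then `log x` shrinks by a constant factor; if the second one does, then
`log (N₀ / N)` grows by a constant factor. A potential of the form
`log log x - log (1 + log (N₀ / N))` hence drops by a constant in every such round. Since its
initial value is of order `log log (N₀ / K)`, comparing the failures with an exponential weight of
the potential shows that `O(log log (N₀ / K))` rounds reach `N = O(K)` with probability at least
`1 - δ / 2`. From there on, every CMY round shrinks the threshold by a constant factor, which takes
`O(log log (k / δ))` rounds until `N < 4 k`.

The learning round collects a constant fraction of `N₀`. A line-crossing inequality, which is
uniform over the random length of this round, shows that no player is undercounted, up to a
probability of `δ / 2`. This makes every `μ̂ᵢ` an upper bound for `μᵢ` up to small errors.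
-/

open MeasureTheory ProbabilityTheory

namespace DistTracking

/-! ### Streams of independent items -/

section ItemAlgebra

variable {Ω ι : Type*} [MeasurableSpace ι]

/-- The σ-algebra generated by the items with index in `S`. -/
@[reducible] def itemAlgebra (X : ℕ → Ω → ι) (S : Set ℕ) : MeasurableSpace Ω :=
  ⨆ j ∈ S, MeasurableSpace.comap (X j) inferInstance

variable {X : ℕ → Ω → ι} {S J : Set ℕ}

theorem comap_le_itemAlgebra {j : ℕ} (hj : j ∈ S) :
    MeasurableSpace.comap (X j) inferInstance ≤ itemAlgebra X S :=
  le_biSup (fun j => MeasurableSpace.comap (X j) inferInstance) hj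

theorem itemAlgebra_mono {T : Set ℕ} (h : S ⊆ T) : itemAlgebra X S ≤ itemAlgebra X T :=
  biSup_mono fun _ hj => h hj

theorem measurableSet_itemAlgebra_of_dependsOn [Countable ι] [MeasurableSingletonClass ι]
    (hJ : J.Finite) (hJS : J ⊆ S) {Q : (ℕ → ι) → Prop} (hQ : DependsOn Q J) :
    MeasurableSet[itemAlgebra X S] {ω | Q fun j => X j ω} := by
  have := hJ.to_subtype
  obtain ⟨Q', rfl⟩ := dependsOn_iff_exists_comp.1 hQ
  have hrestrict : Measurable[itemAlgebra X S] fun ω (j : J) => X j ω :=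
    (@measurable_pi_iff _ _ _ (itemAlgebra X S) _ _).2 fun j =>
      (comap_measurable (X j)).mono (comap_le_itemAlgebra (hJS j.2)) le_rfl
  exact hrestrict (MeasurableSet.of_discrete (s := {v | Q' v}))

end ItemAlgebra

/-- A stream of independent items, each of which has the value `i` with probability `μ i`. -/
structure IsItemStream {Ω ι : Type*} [MeasurableSpace Ω] [MeasurableSpace ι] (P : Measure Ω)
    (X : ℕ → Ω → ι) (μ : ι → ℝ) : Prop where
  measurable : ∀ j, Measurable (X j)
  iIndepFun : iIndepFun X P
  law : ∀ j i, P.real {ω | X j ω = i} = μ i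

namespace IsItemStream

variable {Ω ι : Type*} [MeasurableSpace Ω] [MeasurableSpace ι] {P : Measure Ω} {X : ℕ → Ω → ι}
  {μ : ι → ℝ}

theorem itemAlgebra_le (h : IsItemStream P X μ) (S : Set ℕ) :
    itemAlgebra X S ≤ ‹MeasurableSpace Ω› :=
  iSup₂_le fun j _ => (h.measurable j).comap_le

theorem measureReal_inter (h : IsItemStream P X μ) {S T : Set ℕ} (hST : Disjoint S T)
    {A B : Set Ω} (hA : MeasurableSet[itemAlgebra X S] A) (hB : MeasurableSet[itemAlgebra X T] B) :
    P.real (A ∩ B) = P.real A * P.real B := by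
  have hindep : Indep (itemAlgebra X S) (itemAlgebra X T) P :=
    indep_iSup_of_disjoint (fun j => (h.measurable j).comap_le) h.iIndepFun.iIndep hST
  simp only [measureReal_def, (Indep_iff _ _ _).1 hindep A B hA hB, ENNReal.toReal_mul]

theorem nonneg (h : IsItemStream P X μ) (i : ι) : 0 ≤ μ i :=
  h.law 0 i ▸ measureReal_nonneg

variable [IsProbabilityMeasure P] [MeasurableSingletonClass ι]

theorem measureReal_mem (h : IsItemStream P X μ) (j : ℕ) (A : Finset ι) :
    P.real {ω | X j ω ∈ A} = ∑ i ∈ A, μ i := by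
  have hunion : {ω | X j ω ∈ A} = ⋃ i ∈ A, {ω | X j ω = i} := by ext; simp
  rw [hunion, measureReal_biUnion_finset]
  · exact Finset.sum_congr rfl fun i _ => h.law j i
  · exact fun a _ b _ hab => Set.disjoint_left.2 fun ω ha hb => hab (ha.symm.trans hb)
  · exact fun i _ => h.measurable j (measurableSet_singleton i)

theorem sum_le_one (h : IsItemStream P X μ) (A : Finset ι) : ∑ i ∈ A, μ i ≤ 1 :=
  h.measureReal_mem 0 A ▸ measureReal_le_one

theorem sum_eq_one [Fintype ι] (h : IsItemStream P X μ) : ∑ i, μ i = 1 := by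
  rw [← h.measureReal_mem 0 Finset.univ]
  simp

theorem measureReal_eq_of_next (h : IsItemStream P X μ) (p : ℕ) (A : Finset ι)
    {E B C : Set Ω}
    (hB : MeasurableSet[itemAlgebra X (Set.Ici (p + 1))] B)
    (hC : MeasurableSet[itemAlgebra X (Set.Ici (p + 1))] C)
    (hEB : ∀ ω, X p ω ∈ A → (ω ∈ E ↔ ω ∈ B)) (hEC : ∀ ω, X p ω ∉ A → (ω ∈ E ↔ ω ∈ C)) :
    P.real E = (∑ i ∈ A, μ i) * P.real B + (1 - ∑ i ∈ A, μ i) * P.real C := by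
  have hdisj : Disjoint {p} (Set.Ici (p + 1)) := by simp
  have hA : MeasurableSet[itemAlgebra X {p}] {ω | X p ω ∈ A} :=
    comap_le_itemAlgebra (Set.mem_singleton p) _ ⟨A, A.measurableSet, rfl⟩
  have hA' := h.itemAlgebra_le _ _ hA
  have hinter : E ∩ {ω | X p ω ∈ A} = {ω | X p ω ∈ A} ∩ B := by
    ext ω
    exact ⟨fun ⟨hE, hω⟩ => ⟨hω, (hEB ω hω).1 hE⟩, fun ⟨hω, hb⟩ => ⟨(hEB ω hω).2 hb, hω⟩⟩
  have hdiff : E \ {ω | X p ω ∈ A} = {ω | X p ω ∈ A}ᶜ ∩ C := by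
    ext ω
    exact ⟨fun ⟨hE, hω⟩ => ⟨hω, (hEC ω hω).1 hE⟩, fun ⟨hω, hc⟩ => ⟨(hEC ω hω).2 hc, hω⟩⟩
  rw [← measureReal_inter_add_sdiff (s := E) hA', hinter, hdiff, h.measureReal_inter hdisj hA hB,
    h.measureReal_inter hdisj hA.compl hC, probReal_compl_eq_one_sub hA', h.measureReal_mem]

end IsItemStream

section SetCount

variable {ι : Type*} [DecidableEq ι]

/-- The number of items with value in `A` among the `m` items after the first `p`. -/
def setCount (a : ℕ → ι) (p m : ℕ) (A : Finset ι) : ℕ :=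
  ((Finset.range m).filter fun j => a (p + j) ∈ A).card

theorem setCount_zero (a : ℕ → ι) (p : ℕ) (A : Finset ι) : setCount a p 0 A = 0 := by
  simp [setCount]

theorem setCount_succ (a : ℕ → ι) (p m : ℕ) (A : Finset ι) :
    setCount a p (m + 1) A = (if a p ∈ A then 1 else 0) + setCount a (p + 1) m A := by
  simp only [setCount, Finset.card_filter, Finset.sum_range_succ', add_zero, add_assoc,
    add_comm 1, add_comm (if a p ∈ A then 1 else 0)]

theorem dependsOn_setCount (p m : ℕ) (A : Finset ι) :
    DependsOn (fun a : ℕ → ι => setCount a p m A) (Set.Ico p (p + m)) := by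
  intro a b hab
  refine congrArg Finset.card (Finset.filter_congr fun j hj => ?_)
  rw [hab (p + j) (by simpa using hj)]

theorem measurableSet_le_setCount {Ω : Type*} [MeasurableSpace ι] [Countable ι]
    [MeasurableSingletonClass ι] (X : ℕ → Ω → ι) (p m : ℕ) (A : Finset ι) (x : ℝ) :
    MeasurableSet[itemAlgebra X (Set.Ici p)] {ω | x ≤ setCount (fun j => X j ω) p m A} :=
  measurableSet_itemAlgebra_of_dependsOn (Set.finite_Ico p (p + m)) Set.Ico_subset_Ici_self
    (Q := fun a => x ≤ setCount a p m A)
    fun _ _ hab => by simp only [dependsOn_setCount p m A hab]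

end SetCount

section Counter

variable {k : ℕ}

theorem setCount_singleton (a : ℕ → Fin k) (p m : ℕ) (i : Fin k) :
    setCount a p m {i} = counter a p m i := by
  simp [counter, setCount]

theorem sum_counter_eq_setCount (a : ℕ → Fin k) (p m : ℕ) (A : Finset (Fin k)) :
    ∑ i ∈ A, counter a p m i = setCount a p m A := by
  simp only [setCount, counter, Finset.card_filter]
  rw [Finset.sum_comm]
  simp

theorem sum_counter (a : ℕ → Fin k) (p m : ℕ) : ∑ i, counter a p m i = m := by
  simp [sum_counter_eq_setCount, setCount]

theorem counter_mono (a : ℕ → Fin k) (p : ℕ) (i : Fin k) : Monotone fun m => counter a p m i :=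
  fun _ _ h => Finset.card_le_card (Finset.filter_subset_filter _ (Finset.range_subset_range.2 h))

theorem dependsOn_counter (p m : ℕ) :
    DependsOn (fun a : ℕ → Fin k => counter a p m) (Set.Ico p (p + m)) := by
  intro a b hab
  ext i
  simp only [← setCount_singleton]
  exact dependsOn_setCount p m {i} hab

end Counter

/-! ### Tails of the binomial distribution -/

/-- The probability that the number of successes in `m` independent trials with success probability
`q` is at least `a`. The recursion conditions on the first trial. -/
noncomputable def binTail (q : ℝ) : ℕ → ℝ → ℝ
  | 0, a => if a ≤ 0 then 1 else 0
  | m + 1, a => q * binTail q m (a - 1) + (1 - q) * binTail q m a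

/-- The moment generating function at `θ` of the Bernoulli distribution with parameter `q`. -/
noncomputable def bernoulliMGF (q θ : ℝ) : ℝ := 1 + q * (Real.exp θ - 1)

/-- The parameter of the Bernoulli distribution with parameter `q`, tilted exponentially by `θ`. -/
noncomputable def tiltedMean (q θ : ℝ) : ℝ := q * Real.exp θ / bernoulliMGF q θ

section BinTail

variable {q θ τ a : ℝ} {m : ℕ}

theorem one_le_bernoulliMGF (hq0 : 0 ≤ q) (hθ : 0 ≤ θ) : 1 ≤ bernoulliMGF q θ :=
  le_add_of_nonneg_right (mul_nonneg hq0 (sub_nonneg.2 (Real.one_le_exp hθ)))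

theorem bernoulliMGF_pow_le (hq0 : 0 ≤ q) (hθ : 0 ≤ θ) (hτ : m * q ≤ τ) :
    bernoulliMGF q θ ^ m ≤ Real.exp (τ * (Real.exp θ - 1)) := by
  have hexp : 0 ≤ Real.exp θ - 1 := sub_nonneg.2 (Real.one_le_exp hθ)
  calc bernoulliMGF q θ ^ m ≤ Real.exp (q * (Real.exp θ - 1)) ^ m := by
        have := one_le_bernoulliMGF hq0 hθ
        gcongr
        rw [bernoulliMGF, add_comm]
        exact Real.add_one_le_exp _
    _ = Real.exp (m * q * (Real.exp θ - 1)) := by rw [← Real.exp_nat_mul, mul_assoc]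
    _ ≤ _ := by gcongr

theorem bernoulliMGF_mul_tiltedMean (hq0 : 0 ≤ q) (hθ : 0 ≤ θ) :
    bernoulliMGF q θ * tiltedMean q θ = q * Real.exp θ :=
  mul_div_cancel₀ _ (zero_lt_one.trans_le (one_le_bernoulliMGF hq0 hθ)).ne'

theorem tiltedMean_nonneg (hq0 : 0 ≤ q) (hθ : 0 ≤ θ) : 0 ≤ tiltedMean q θ :=
  div_nonneg (by positivity) (zero_le_one.trans (one_le_bernoulliMGF hq0 hθ))

theorem tiltedMean_le_one (hq0 : 0 ≤ q) (hq1 : q ≤ 1) (hθ : 0 ≤ θ) : tiltedMean q θ ≤ 1 := by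
  refine div_le_one_of_le₀ ?_ (zero_le_one.trans (one_le_bernoulliMGF hq0 hθ))
  rw [bernoulliMGF]
  linarith

theorem tiltedMean_le (hq0 : 0 ≤ q) (hθ : 0 ≤ θ) : tiltedMean q θ ≤ q * Real.exp θ :=
  div_le_self (by positivity) (one_le_bernoulliMGF hq0 hθ)

theorem binTail_le_chernoff (hq0 : 0 ≤ q) (hq1 : q ≤ 1) (hθ : 0 ≤ θ) (m : ℕ) (a : ℝ) :
    binTail q m a ≤ Real.exp (-θ * a) * bernoulliMGF q θ ^ m := by
  induction m generalizing a with
  | zero =>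
    simp only [binTail, pow_zero, mul_one]
    split_ifs with ha
    · exact Real.one_le_exp (by nlinarith)
    · positivity
  | succ m ih =>
    have := sub_nonneg.2 hq1
    calc q * binTail q m (a - 1) + (1 - q) * binTail q m a
        ≤ q * (Real.exp (-θ * (a - 1)) * bernoulliMGF q θ ^ m) +
          (1 - q) * (Real.exp (-θ * a) * bernoulliMGF q θ ^ m) := by gcongr <;> exact ih _
      _ = _ := by
        rw [show -θ * (a - 1) = -θ * a + θ by ring, Real.exp_add, pow_succ]
        simp only [bernoulliMGF]
        ring

theorem binTail_le_chernoff_of_le (hq0 : 0 ≤ q) (hq1 : q ≤ 1) (hθ : 0 ≤ θ) (hτ : m * q ≤ τ)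
    (a : ℝ) : binTail q m a ≤ Real.exp (-θ * a + τ * (Real.exp θ - 1)) := by
  rw [Real.exp_add]
  refine (binTail_le_chernoff hq0 hq1 hθ m a).trans ?_
  gcongr
  exact bernoulliMGF_pow_le hq0 hθ hτ

/-- Markov's inequality for `e ^ (θ Y) (Y - u) ^ 2`, where `Y` is binomially distributed: the last
factor is the second moment of `Y - u` under the tilted distribution. -/
theorem binTail_le_chernoff_mul_sq (hq0 : 0 ≤ q) (hq1 : q ≤ 1) (hθ : 0 ≤ θ) (m : ℕ) {a u : ℝ}
    (hu : u < a) :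
    binTail q m a ≤ Real.exp (-θ * a) * bernoulliMGF q θ ^ m *
      ((m * (tiltedMean q θ * (1 - tiltedMean q θ)) + (m * tiltedMean q θ - u) ^ 2) /
        (a - u) ^ 2) := by
  induction m generalizing a u with
  | zero =>
    simp only [binTail, pow_zero, mul_one, Nat.cast_zero, zero_mul, zero_add, zero_sub, neg_sq]
    split_ifs with ha
    · refine one_le_mul_of_one_le_of_one_le (Real.one_le_exp (by nlinarith)) ?_
      rw [one_le_div (pow_pos (sub_pos.2 hu) 2)]
      nlinarith
    · positivity
  | succ m ih =>
    have := sub_nonneg.2 hq1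
    have := (pow_pos (sub_pos.2 hu) 2).ne'
    have hMg := bernoulliMGF_mul_tiltedMean hq0 hθ
    have hM : bernoulliMGF q θ = 1 + q * (Real.exp θ - 1) := rfl
    set M := bernoulliMGF q θ
    set g := tiltedMean q θ
    calc q * binTail q m (a - 1) + (1 - q) * binTail q m a
        ≤ q * (Real.exp (-θ * (a - 1)) * M ^ m *
            ((m * (g * (1 - g)) + (m * g - (u - 1)) ^ 2) / (a - 1 - (u - 1)) ^ 2)) +
          (1 - q) * (Real.exp (-θ * a) * M ^ m *
            ((m * (g * (1 - g)) + (m * g - u) ^ 2) / (a - u) ^ 2)) := by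
          gcongr
          · exact ih (by linarith)
          · exact ih hu
      _ = Real.exp (-θ * a) * M ^ m * ((M * g * (m * (g * (1 - g)) + (m * g - (u - 1)) ^ 2) +
            (M - M * g) * (m * (g * (1 - g)) + (m * g - u) ^ 2)) / (a - u) ^ 2) := by
          rw [show -θ * (a - 1) = -θ * a + θ by ring, Real.exp_add,
            show a - 1 - (u - 1) = a - u by ring, hMg, hM]
          field_simp
          ring
      _ = _ := by
          push_cast
          rw [pow_succ]
          field_simp
          ring

theorem binTail_le_chernoff_mul_cantelli (hq0 : 0 ≤ q) (hq1 : q ≤ 1) (hθ : 0 ≤ θ)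
    {V D : ℝ} (hV : V = m * (tiltedMean q θ * (1 - tiltedMean q θ)))
    (hD : D = a - m * tiltedMean q θ) (hD0 : 0 < D) :
    binTail q m a ≤ Real.exp (-θ * a) * bernoulliMGF q θ ^ m * (V / (V + D ^ 2)) := by
  have hV0 : 0 ≤ V := by
    have := tiltedMean_nonneg hq0 hθ
    have := sub_nonneg.2 (tiltedMean_le_one hq0 hq1 hθ)
    rw [hV]
    positivity
  have hVD : 0 ≤ V / D := by positivity
  -- The shift `u = m g - V / D` minimises the second moment bound.
  convert binTail_le_chernoff_mul_sq hq0 hq1 hθ m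
    (show m * tiltedMean q θ - V / D < a by linarith) using 2
  rw [← hV, sub_sub_cancel, show a - (m * tiltedMean q θ - V / D) = D + V / D by rw [hD]; ring,
    show D + V / D = (V + D ^ 2) / D by field_simp; ring]
  have : 0 < V + D ^ 2 := by positivity
  field_simp
  ring

theorem binTail_le_chernoff_mul_cantelli_of_le (hq0 : 0 ≤ q) (hq1 : q ≤ 1) (hθ : 0 ≤ θ)
    (hτ : m * q ≤ τ) {d : ℝ} (hd : 0 < d) (hda : d ≤ a - τ * Real.exp θ) :
    binTail q m a ≤ Real.exp (-θ * a + τ * (Real.exp θ - 1)) *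
      (τ * Real.exp θ / (τ * Real.exp θ + d ^ 2)) := by
  have hg0 := tiltedMean_nonneg hq0 hθ
  have hτ0 : 0 ≤ τ := (by positivity : 0 ≤ m * q).trans hτ
  have hmean : m * tiltedMean q θ ≤ τ * Real.exp θ := by
    calc m * tiltedMean q θ ≤ m * (q * Real.exp θ) := by gcongr; exact tiltedMean_le hq0 hθ
      _ = m * q * Real.exp θ := by ring
      _ ≤ _ := by gcongr
  have hvar : m * (tiltedMean q θ * (1 - tiltedMean q θ)) ≤ τ * Real.exp θ := by
    refine le_trans ?_ hmean
    gcongr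
    exact mul_le_of_le_one_right hg0 (by linarith)
  have hvar0 : 0 ≤ m * (tiltedMean q θ * (1 - tiltedMean q θ)) := by
    have := sub_nonneg.2 (tiltedMean_le_one hq0 hq1 hθ)
    positivity
  have hdD : d ≤ a - m * tiltedMean q θ := by linarith
  have hD0 : 0 < a - m * tiltedMean q θ := hd.trans_le hdD
  refine (binTail_le_chernoff_mul_cantelli hq0 hq1 hθ rfl rfl hD0).trans ?_
  rw [Real.exp_add]
  gcongr ?_ * ?_ * ?_
  · exact bernoulliMGF_pow_le hq0 hθ hτ
  · have hsq : d ^ 2 ≤ (a - m * tiltedMean q θ) ^ 2 := by gcongr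
    rw [div_le_div_iff₀ (by positivity) (by positivity)]
    linarith [mul_le_mul hvar hsq (by positivity) (by positivity)]

end BinTail

section ExpBounds

variable {θ : ℝ}

theorem exp_le_one_add_add_sq_div (hθ0 : 0 ≤ θ) (hθ3 : θ < 3) :
    Real.exp θ ≤ 1 + θ + θ ^ 2 / (2 * (1 - θ / 3)) := by
  have hexp : HasSum (fun n : ℕ => θ ^ n / n.factorial) (Real.exp θ) := by
    rw [Real.exp_eq_exp_ℝ]
    exact NormedSpace.expSeries_div_hasSum_exp θ
  have hgeom : HasSum (fun n : ℕ => θ ^ 2 / 2 * (θ / 3) ^ n) (θ ^ 2 / 2 * (1 - θ / 3)⁻¹) :=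
    (hasSum_geometric_of_lt_one (by positivity) (by linarith)).mul_left _
  have hterm (n : ℕ) : θ ^ (n + 2) / (n + 2).factorial ≤ θ ^ 2 / 2 * (θ / 3) ^ n := by
    have hfact : (2 * 3 ^ n : ℝ) ≤ (n + 2).factorial := by
      rw [add_comm n 2]
      exact_mod_cast Nat.factorial_mul_pow_le_factorial (m := 2) (n := n)
    calc θ ^ (n + 2) / ((n + 2).factorial : ℝ) ≤ θ ^ (n + 2) / (2 * 3 ^ n) := by gcongr
      _ = θ ^ 2 / 2 * (θ / 3) ^ n := by rw [div_pow, pow_add]; field_simp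
  have htail := hasSum_le hterm ((hasSum_nat_add_iff' 2).2 hexp) hgeom
  simp only [Finset.sum_range_succ, Finset.sum_range_zero, Nat.factorial, pow_zero, pow_one,
    Nat.cast_one, div_one, zero_add, mul_one] at htail
  rw [show θ ^ 2 / (2 * (1 - θ / 3)) = θ ^ 2 / 2 * (1 - θ / 3)⁻¹ by rw [← div_div]; rfl]
  linarith

theorem exp_le_cubic (hθ0 : 0 ≤ θ) (hθ : θ ≤ 1 / 4) :
    Real.exp θ ≤ 1 + θ + θ ^ 2 / 2 + 2 / 11 * θ ^ 3 := by
  refine (exp_le_one_add_add_sq_div hθ0 (by linarith)).trans ?_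
  suffices θ ^ 2 / (2 * (1 - θ / 3)) ≤ θ ^ 2 / 2 + 2 / 11 * θ ^ 3 by linarith
  rw [div_le_iff₀ (by linarith)]
  have : 0 ≤ θ ^ 3 * (1 - 4 * θ) := mul_nonneg (by positivity) (by linarith)
  linarith

theorem exp_half_le : Real.exp (1 / 2) ≤ 1.65 := by
  refine (exp_le_one_add_add_sq_div (by norm_num) (by norm_num)).trans ?_
  norm_num

theorem exp_four_le : Real.exp 4 ≤ 55 := by
  calc Real.exp 4 = Real.exp 1 ^ 4 := by rw [← Real.exp_nat_mul]; norm_num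
    _ ≤ 2.7182818286 ^ 4 := by gcongr; exact Real.exp_one_lt_d9.le
    _ ≤ 55 := by norm_num

theorem exp_neg_le_of_le {x : ℝ} (hx : 0.015 ≤ x) : Real.exp (-x) ≤ 0.99 := by
  rw [Real.exp_neg, inv_le_comm₀ (Real.exp_pos _) (by norm_num)]
  linarith [Real.add_one_le_exp x]

end ExpBounds

section Bernstein

variable {q τ a : ℝ} {m : ℕ}

theorem binTail_le_exp_neg_four_mul_add (hq0 : 0 ≤ q) (hq1 : q ≤ 1) (hτ : m * q ≤ τ) (a : ℝ) :
    binTail q m a ≤ Real.exp (-4 * a + 54 * τ) := by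
  have hτ0 : 0 ≤ τ := (by positivity : 0 ≤ m * q).trans hτ
  refine (binTail_le_chernoff_of_le hq0 hq1 zero_le_four hτ a).trans ?_
  rw [mul_comm 54]
  gcongr
  linarith [exp_four_le]

/-- The Chernoff bound at `θ = v / (1 + v / 3)`, which is optimal up to the cubic terms of `exp`. -/
theorem binTail_le_exp_neg_mul_div (hq0 : 0 ≤ q) (hq1 : q ≤ 1) {B v c : ℝ} (hτ : m * q ≤ τ)
    (hv : 0 ≤ v) (hB : τ * v ^ 2 = 2 * B) (ha : τ + τ * v + c * B ≤ a) :
    binTail q m a ≤ Real.exp (-(B * (1 + c * v) / (1 + v / 3))) := by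
  have hτ0 : 0 ≤ τ := (by positivity : 0 ≤ m * q).trans hτ
  obtain ⟨θ, hθ⟩ : ∃ θ, θ = v / (1 + v / 3) := ⟨_, rfl⟩
  have hθ0 : 0 ≤ θ := hθ ▸ by positivity
  have hcompl : 1 - θ / 3 = 1 / (1 + v / 3) := by rw [hθ]; field_simp; ring
  have hθ3 : θ < 3 := by
    have : 0 < 1 / (1 + v / 3) := by positivity
    linarith
  have hexp : Real.exp θ - 1 ≤ θ + v ^ 2 / 2 / (1 + v / 3) := by
    have := exp_le_one_add_add_sq_div hθ0 hθ3
    rw [hcompl, show θ ^ 2 / (2 * (1 / (1 + v / 3))) = v ^ 2 / 2 / (1 + v / 3) by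
      rw [hθ]; field_simp] at this
    linarith
  refine (binTail_le_chernoff_of_le hq0 hq1 hθ0 hτ a).trans (Real.exp_le_exp.2 ?_)
  calc -θ * a + τ * (Real.exp θ - 1)
      ≤ -θ * (τ + τ * v + c * B) + τ * (θ + v ^ 2 / 2 / (1 + v / 3)) := by
        linarith [mul_le_mul_of_nonneg_left ha hθ0, mul_le_mul_of_nonneg_left hexp hτ0]
    _ = -((τ * v ^ 2 / 2 + c * B * v) / (1 + v / 3)) := by rw [hθ]; field_simp; ring
    _ = _ := by rw [hB]; ring

theorem binTail_le_bernstein (hq0 : 0 ≤ q) (hq1 : q ≤ 1) {B : ℝ} (hτ : m * q ≤ τ) (hτ0 : 0 < τ)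
    (hB : 0 ≤ B) (ha : τ + √(2 * τ * B) + B / 3 ≤ a) : binTail q m a ≤ Real.exp (-B) := by
  have hsqrt : τ * √(2 * B / τ) = √(2 * τ * B) := by
    rw [show 2 * τ * B = τ ^ 2 * (2 * B / τ) by field_simp, Real.sqrt_mul (by positivity),
      Real.sqrt_sq hτ0.le]
  have : 0 < 1 + √(2 * B / τ) / 3 := by positivity
  convert binTail_le_exp_neg_mul_div (a := a) (c := 1 / 3) (B := B) hq0 hq1 hτ
    (Real.sqrt_nonneg (2 * B / τ)) (by rw [Real.sq_sqrt (by positivity)]; field_simp)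
    (by rw [hsqrt]; linarith) using 2
  field_simp

theorem sq_mul_exp_le {s g θ : ℝ} (hθ : θ * s = g - 1) (hθ0 : 0 ≤ θ) (hθ1 : θ ≤ 1 / 4) :
    s ^ 2 * Real.exp θ ≤ s ^ 2 + (g - 1) * s + (g - 1) ^ 2 * (1 / 2 + 2 / 11 * θ) := by
  calc s ^ 2 * Real.exp θ ≤ s ^ 2 * (1 + θ + θ ^ 2 / 2 + 2 / 11 * θ ^ 3) := by
        gcongr
        exact exp_le_cubic hθ0 hθ1
    _ = s ^ 2 + θ * s * s + (θ * s) ^ 2 * (1 / 2 + 2 / 11 * θ) := by ring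
    _ = _ := by rw [hθ]

/-- With `s` the standard deviation and `g` the deviation in units of `s`, tilt by `(g - 1) / s`
instead of the optimal `g / s`: this costs a factor `exp (1 / 2) ≤ 1.65`, but leaves one standard
deviation for Cantelli's inequality, which gains a factor `0.56`. -/
theorem binTail_le_of_pow_three_lt (hq0 : 0 ≤ q) (hq1 : q ≤ 1) {s g : ℝ} (hs : 0 < s)
    (hτ : m * q ≤ s ^ 2) (hg : 1.177 ≤ g) (hgs : g ^ 3 < 0.16 * s)
    (ha : s ^ 2 + g * s + 7 / 24 * g ^ 2 ≤ a) :
    binTail q m a ≤ 0.99 * Real.exp (-(g ^ 2 / 2)) := by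
  obtain ⟨θ, hθ⟩ : ∃ θ, θ * s = g - 1 := ⟨(g - 1) / s, by field_simp⟩
  have hθ0 : 0 ≤ θ := by nlinarith
  have hg_sq : g ^ 2 ≤ 0.136 * s := by nlinarith [sq_nonneg g]
  have hg_le : g ≤ 0.1156 * s := by nlinarith
  have hθ1 : θ ≤ 0.1156 := le_of_mul_le_mul_right (by linarith) hs
  have htilt := sq_mul_exp_le hθ hθ0 (hθ1.trans (by norm_num))
  have hsub_sq : (g - 1) ^ 2 ≤ g ^ 2 := by gcongr <;> linarith
  have hdist : 0.96 * s ≤ a - s ^ 2 * Real.exp θ := by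
    have : (g - 1) ^ 2 * θ ≤ 0.136 * s * 0.1156 := by gcongr; linarith [hsub_sq]
    linarith
  have hexponent : -θ * a + s ^ 2 * (Real.exp θ - 1) ≤ -(g ^ 2 / 2) + 1 / 2 := by
    have hθa := mul_le_mul_of_nonneg_left ha hθ0
    have hrem : θ * ((g - 1) ^ 2 * (2 / 11)) ≤ θ * (7 / 24 * g ^ 2) := by
      refine mul_le_mul_of_nonneg_left ?_ hθ0
      linarith [sq_nonneg g]
    have hmul : θ * (s ^ 2 + g * s + 7 / 24 * g ^ 2) =
        (g - 1) * s + (g - 1) * g + θ * (7 / 24 * g ^ 2) := by rw [← hθ]; ring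
    linarith
  have hcantelli : s ^ 2 * Real.exp θ / (s ^ 2 * Real.exp θ + (0.96 * s) ^ 2) ≤ 0.56 := by
    have hexp : Real.exp θ ≤ 1.13 := by
      have := exp_le_one_add_add_sq_div hθ0 (by linarith)
      have : θ ^ 2 / (2 * (1 - θ / 3)) ≤ 0.1156 ^ 2 / (2 * (1 - 0.1156 / 3)) := by gcongr
      norm_num at this hθ1 ⊢
      linarith
    rw [div_le_iff₀ (by positivity)]
    linarith [mul_le_mul_of_nonneg_left hexp (sq_nonneg s), mul_pow 0.96 s 2, sq_nonneg s]
  calc binTail q m a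
      ≤ Real.exp (-θ * a + s ^ 2 * (Real.exp θ - 1)) * _ :=
        binTail_le_chernoff_mul_cantelli_of_le hq0 hq1 hθ0 hτ (by positivity) hdist
    _ ≤ Real.exp (-(g ^ 2 / 2) + 1 / 2) * 0.56 := by gcongr
    _ = Real.exp (-(g ^ 2 / 2)) * (Real.exp (1 / 2) * 0.56) := by rw [Real.exp_add]; ring
    _ ≤ Real.exp (-(g ^ 2 / 2)) * 0.99 := by gcongr; linarith [exp_half_le]
    _ = _ := mul_comm _ _

theorem binTail_le_of_le_pow_three (hq0 : 0 ≤ q) (hq1 : q ≤ 1) {s g : ℝ} (hs : 0 < s)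
    (hτ : m * q ≤ s ^ 2) (hg : 1.177 ≤ g) (hgs : 0.16 * s ≤ g ^ 3)
    (ha : s ^ 2 + g * s + 7 / 24 * g ^ 2 ≤ a) :
    binTail q m a ≤ 0.99 * Real.exp (-(g ^ 2 / 2)) := by
  obtain ⟨v, hv⟩ : ∃ v, v * s = g := ⟨g / s, by field_simp⟩
  have hv0 : 0 < v := pos_of_mul_pos_left (by linarith) hs.le
  have hgv : 0.16 ≤ g ^ 2 * v := le_of_mul_le_mul_right (by linear_combination hgs - g ^ 2 * hv) hs
  have hgain : 0.015 ≤ g ^ 2 * v / 8 / (1 + v / 3) := by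
    rw [le_div_iff₀ (by positivity)]
    nlinarith [hgv]
  calc binTail q m a
      ≤ Real.exp (-(g ^ 2 / 2 * (1 + 7 / 12 * v) / (1 + v / 3))) :=
        binTail_le_exp_neg_mul_div hq0 hq1 hτ hv0.le (by rw [← hv]; ring)
          (by linear_combination ha + s * hv)
    _ = Real.exp (-(g ^ 2 * v / 8 / (1 + v / 3))) * Real.exp (-(g ^ 2 / 2)) := by
        rw [← Real.exp_add]
        congr 1
        field_simp
        ring
    _ ≤ _ := by gcongr; exact exp_neg_le_of_le hgain

/-- The failure probability `δ` of a round may be close to `1`, so Bernstein's bound `exp (-B)`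
has to be beaten by a constant factor. -/
theorem binTail_le_bernstein_improved (hq0 : 0 ≤ q) (hq1 : q ≤ 1) {B : ℝ} (hτ : m * q ≤ τ)
    (hτ0 : 0 < τ) (hB : 0.693 ≤ B) (ha : τ + √(2 * τ * B) + 7 / 12 * B ≤ a) :
    binTail q m a ≤ 0.99 * Real.exp (-B) := by
  have hs : √τ ^ 2 = τ := Real.sq_sqrt hτ0.le
  have hg : √(2 * B) ^ 2 = 2 * B := Real.sq_sqrt (by linarith)
  have hg_ge : 1.177 ≤ √(2 * B) := Real.le_sqrt_of_sq_le (by norm_num; linarith)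
  have hmul : √(2 * B) * √τ = √(2 * τ * B) := by
    rw [← Real.sqrt_mul (by linarith)]
    ring_nf
  have ha' : √τ ^ 2 + √(2 * B) * √τ + 7 / 24 * √(2 * B) ^ 2 ≤ a := by rw [hs, hg, hmul]; linarith
  have hB' : B = √(2 * B) ^ 2 / 2 := by linarith
  rw [← hs] at hτ
  rw [hB']
  rcases lt_or_ge (√(2 * B) ^ 3) (0.16 * √τ) with hclt | hpoisson
  · exact binTail_le_of_pow_three_lt hq0 hq1 (Real.sqrt_pos.2 hτ0) hτ hg_ge hclt ha'
  · exact binTail_le_of_le_pow_three hq0 hq1 (Real.sqrt_pos.2 hτ0) hτ hg_ge hpoisson ha'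

end Bernstein

/-! ### Tails of the counters -/

section Line

variable {ι : Type*} [DecidableEq ι]

theorem exists_setCount_le_line_succ_iff (a : ℕ → ι) (p n : ℕ) (A : Finset ι) (θ c : ℝ) {u : ℝ}
    (hu : 0 < u) :
    (∃ m ≤ n + 1, θ * setCount a p m A + u ≤ c * m) ↔
      ∃ m ≤ n, θ * setCount a (p + 1) m A + (u + (if a p ∈ A then θ else 0) - c) ≤ c * m := by
  have hstep (m : ℕ) : θ * setCount a p (m + 1) A + u ≤ c * (m + 1 : ℕ) ↔
      θ * setCount a (p + 1) m A + (u + (if a p ∈ A then θ else 0) - c) ≤ c * m := by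
    rw [setCount_succ]
    push_cast
    split_ifs <;> constructor <;> intro <;> linarith
  constructor
  · rintro ⟨_ | m, hm, hle⟩
    · simp [setCount_zero, hu.not_ge] at hle
    · exact ⟨m, Nat.succ_le_succ_iff.1 hm, (hstep m).1 hle⟩
  · rintro ⟨m, hm, hle⟩
    exact ⟨m + 1, Nat.succ_le_succ hm, (hstep m).2 hle⟩

theorem measurableSet_exists_setCount_le_line {Ω : Type*} [MeasurableSpace ι] [Countable ι]
    [MeasurableSingletonClass ι] (X : ℕ → Ω → ι) (p n : ℕ) (A : Finset ι) (θ u c : ℝ) :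
    MeasurableSet[itemAlgebra X (Set.Ici p)]
      {ω | ∃ m ≤ n, θ * setCount (fun j => X j ω) p m A + u ≤ c * m} := by
  refine measurableSet_itemAlgebra_of_dependsOn (Set.finite_Ico p (p + n)) Set.Ico_subset_Ici_self
    (Q := fun a => ∃ m ≤ n, θ * setCount a p m A + u ≤ c * m) fun a b hab => propext ?_
  refine exists_congr fun m => and_congr_right fun hm => ?_
  have hcount : setCount a p m A = setCount b p m A :=
    dependsOn_setCount p m A fun j hj => hab j ⟨hj.1, hj.2.trans_le (Nat.add_le_add_left hm p)⟩
  rw [hcount]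

end Line

namespace IsItemStream

variable {Ω ι : Type*} [MeasurableSpace Ω] {P : Measure Ω} [IsProbabilityMeasure P]
  [DecidableEq ι] [MeasurableSpace ι] [MeasurableSingletonClass ι]
  {X : ℕ → Ω → ι} {μ : ι → ℝ}

theorem measureReal_le_setCount_hoeffding (h : IsItemStream P X μ) (A : Finset ι) (p m : ℕ) {y : ℝ}
    (hy : 0 ≤ y) :
    P.real {ω | m * ∑ i ∈ A, μ i + y ≤ setCount (fun j => X j ω) p m A} ≤
      Real.exp (-(2 * y ^ 2 / m)) := by
  let f : ι → ℝ := (A : Set ι).indicator 1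
  have hf : Measurable f := measurable_one.indicator A.measurableSet
  have hmean (j : ℕ) : ∫ ω, f (X j ω) ∂P = ∑ i ∈ A, μ i := by
    rw [← h.measureReal_mem j A]
    exact integral_indicator_one (h.measurable j A.measurableSet)
  have hsub (j : ℕ) : HasSubgaussianMGF (fun ω => f (X j ω) - ∑ i ∈ A, μ i) (1 / 4) P := by
    convert hasSubgaussianMGF_of_mem_Icc (a := 0) (b := 1) (hf.comp (h.measurable j)).aemeasurable
      (ae_of_all P fun ω => ?_) using 1
    · simp [← hmean j]
    · norm_num
    · by_cases hω : X j ω ∈ A <;> simp [f, hω]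
  have hindep : ProbabilityTheory.iIndepFun (fun j ω => f (X (p + j) ω) - ∑ i ∈ A, μ i) P :=
    (h.iIndepFun.precomp (add_right_injective p)).comp (fun _ x => f x - ∑ i ∈ A, μ i)
      fun _ => hf.sub_const _
  convert HasSubgaussianMGF.measure_sum_range_ge_le_of_iIndepFun hindep (n := m)
    (fun j _ => hsub (p + j)) hy using 2
  · ext ω
    simp [setCount, f, Set.indicator_apply, le_sub_iff_add_le, add_comm y]
  · simp
    ring

theorem measureReal_le_setCount_hoeffding_of_le (h : IsItemStream P X μ) (A : Finset ι) (p : ℕ)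
    {m n : ℕ} (hmn : m ≤ n) {y : ℝ} (hy : 0 < y) :
    P.real {ω | m * ∑ i ∈ A, μ i + y ≤ setCount (fun j => X j ω) p m A} ≤
      Real.exp (-(2 * y ^ 2 / n)) := by
  rcases m.eq_zero_or_pos with rfl | hm
  · simp [setCount_zero, hy.not_ge, Real.exp_nonneg]
  · refine (h.measureReal_le_setCount_hoeffding A p m hy.le).trans ?_
    gcongr

variable [Countable ι]

theorem measureReal_le_setCount (h : IsItemStream P X μ) (A : Finset ι) (p m : ℕ) (x : ℝ) :
    P.real {ω | x ≤ setCount (fun j => X j ω) p m A} = binTail (∑ i ∈ A, μ i) m x := by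
  induction m generalizing p x with
  | zero =>
    simp only [setCount_zero, binTail, Nat.cast_zero]
    split_ifs with hx <;> simp [hx]
  | succ m ih =>
    rw [h.measureReal_eq_of_next p A (measurableSet_le_setCount X (p + 1) m A (x - 1))
      (measurableSet_le_setCount X (p + 1) m A x), ih, ih, binTail]
    · intro ω hω
      simp [setCount_succ, hω, add_comm]
    · intro ω hω
      simp [setCount_succ, hω]

/-- A maximal inequality: `exp (c m - θ * setCount)` is a supermartingale in the number `m` of
items. -/
theorem measureReal_exists_setCount_le_line (h : IsItemStream P X μ) (A : Finset ι) {θ c : ℝ}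
    (hc : (∑ i ∈ A, μ i) * Real.exp (-θ) + (1 - ∑ i ∈ A, μ i) ≤ Real.exp (-c)) (p n : ℕ) (u : ℝ) :
    P.real {ω | ∃ m ≤ n, θ * setCount (fun j => X j ω) p m A + u ≤ c * m} ≤ Real.exp (-u) := by
  have hq0 : 0 ≤ ∑ i ∈ A, μ i := Finset.sum_nonneg fun i _ => h.nonneg i
  have hq1 : 0 ≤ 1 - ∑ i ∈ A, μ i := sub_nonneg.2 (h.sum_le_one A)
  induction n generalizing p u with
  | zero =>
    rcases le_or_gt u 0 with hu | hu
    · exact measureReal_le_one.trans (Real.one_le_exp (by linarith))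
    · simp [setCount_zero, hu.not_ge, Real.exp_nonneg]
  | succ n ih =>
    rcases le_or_gt u 0 with hu | hu
    · exact measureReal_le_one.trans (Real.one_le_exp (by linarith))
    rw [h.measureReal_eq_of_next
      (E := {ω | ∃ m ≤ n + 1, θ * setCount (fun j => X j ω) p m A + u ≤ c * m}) p A
      (measurableSet_exists_setCount_le_line X (p + 1) n A θ (u + θ - c) c)
      (measurableSet_exists_setCount_le_line X (p + 1) n A θ (u - c) c)
      (fun ω hω => by simp [exists_setCount_le_line_succ_iff _ p n A θ c hu, hω])
      (fun ω hω => by simp [exists_setCount_le_line_succ_iff _ p n A θ c hu, hω])]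
    calc (∑ i ∈ A, μ i) * P.real _ + (1 - ∑ i ∈ A, μ i) * P.real _
        ≤ (∑ i ∈ A, μ i) * Real.exp (-(u + θ - c)) +
          (1 - ∑ i ∈ A, μ i) * Real.exp (-(u - c)) := by gcongr <;> exact ih _ _
      _ = ((∑ i ∈ A, μ i) * Real.exp (-θ) + (1 - ∑ i ∈ A, μ i)) * Real.exp (-u + c) := by
        rw [show -(u + θ - c) = -θ + (-u + c) by ring, show -(u - c) = -u + c by ring, Real.exp_add]
        ring
      _ ≤ Real.exp (-c) * Real.exp (-u + c) := by gcongr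
      _ = Real.exp (-u) := by rw [← Real.exp_add]; ring_nf

end IsItemStream

/-! ### Rounds -/

section Rounds

variable {k : ℕ} {R : RoundRule k} {a : ℕ → Fin k} {p m : ℕ}

theorem RoundRule.endsAt_iff : R.EndsAt a p m ↔
    R.ell ≤ ∑ i, R.sent i (counter a p m i) ∧
      ∀ m' < m, ∑ i, R.sent i (counter a p m' i) < R.ell := by
  refine and_congr_right fun _ => forall_congr' fun m' => ?_
  rw [← not_imp_not, not_le, Set.mem_ofPred_eq, not_le]

theorem RoundRule.dependsOn_endsAt (R : RoundRule k) (p m : ℕ) :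
    DependsOn (fun a => R.EndsAt a p m) (Set.Ico p (p + m)) := by
  intro a b hab
  have hcounter : ∀ m' ≤ m, counter a p m' = counter b p m' := fun m' hm' =>
    dependsOn_counter p m' fun j hj => hab j (Set.Ico_subset_Ico_right (by omega) hj)
  simp only [RoundRule.endsAt_iff]
  refine propext (and_congr (by rw [hcounter m le_rfl]) (forall₂_congr fun m' hm' => ?_))
  rw [hcounter m' hm'.le]

theorem exists_le_counter (hk : 0 < k) (a : ℕ → Fin k) (p n : ℕ) :
    ∃ i, n ≤ counter a p (k * n) i := by
  have : Nonempty (Fin k) := ⟨⟨0, hk⟩⟩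
  by_contra! hlt
  have hsum : ∑ i, counter a p (k * n) i < ∑ _i : Fin k, n :=
    Finset.sum_lt_sum_of_nonempty Finset.univ_nonempty fun i _ => hlt i
  simp [sum_counter] at hsum

theorem RoundRule.exists_endsAt (hk : 0 < k)
    (hR : ∃ n₀, ∀ i, ∀ n ≥ n₀, R.ell ≤ R.sent i n) (a : ℕ → Fin k) (p : ℕ) :
    ∃ m, R.EndsAt a p m := by
  obtain ⟨n₀, hsent⟩ := hR
  obtain ⟨i, hi⟩ := exists_le_counter hk a p n₀
  have hend : ∃ m, R.ell ≤ ∑ i, R.sent i (counter a p m i) :=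
    ⟨k * n₀, (hsent i _ hi).trans <| Finset.single_le_sum
      (f := fun i => R.sent i (counter a p (k * n₀) i)) (fun _ _ => Nat.zero_le _)
      (Finset.mem_univ i)⟩
  classical exact ⟨Nat.find hend, Nat.find_spec hend, fun m' hm' => Nat.find_min' hend hm'⟩

/-- In a run from threshold `N` in which every round is played by `rule`, the remaining threshold
exceeds `T` before each of the first `n` rounds and after the last of them. -/
def Unfinished {k : ℕ} (T : ℝ) (rule : ℕ → RoundRule k) (a : ℕ → Fin k) : ℕ → ℕ → ℕ → Prop
  | 0, _, N => T < N
  | n + 1, p, N => T < N ∧ ∃ m, (rule N).EndsAt a p m ∧ Unfinished T rule a n (p + m) (N - m)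

theorem Unfinished.lt {T : ℝ} {rule : ℕ → RoundRule k} {n N : ℕ}
    (h : Unfinished T rule a n p N) : T < N := by
  cases n with
  | zero => exact h
  | succ n => exact h.1

end Rounds

section Measurability

variable {Ω : Type*} {k : ℕ} {X : ℕ → Ω → Fin k}

theorem measurableSet_endsAt (R : RoundRule k) (p m : ℕ) {S : Set ℕ}
    (hS : Set.Ico p (p + m) ⊆ S) :
    MeasurableSet[itemAlgebra X S] {ω | R.EndsAt (fun j => X j ω) p m} :=
  measurableSet_itemAlgebra_of_dependsOn (Set.finite_Ico p (p + m)) hS (R.dependsOn_endsAt p m)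

theorem measurableSet_unfinished (T : ℝ) (rule : ℕ → RoundRule k) (n p N : ℕ) :
    MeasurableSet[itemAlgebra X (Set.Ici p)]
      {ω | Unfinished T rule (fun j => X j ω) n p N} := by
  induction n generalizing p N with
  | zero => exact MeasurableSet.const _
  | succ n ih =>
    simp only [Unfinished, Set.ofPred_and, Set.ofPred_exists]
    refine (MeasurableSet.const _).inter (MeasurableSet.iUnion fun m => ?_)
    exact (measurableSet_endsAt _ _ _ Set.Ico_subset_Ici_self).inter
      (itemAlgebra_mono (Set.Ici_subset_Ici.2 (Nat.le_add_right p m)) _ (ih _ _))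

end Measurability

section UnfinishedMeasure

variable {Ω : Type*} [MeasurableSpace Ω] {P : Measure Ω} {k : ℕ} {X : ℕ → Ω → Fin k} {T : ℝ}
  {rule : ℕ → RoundRule k} {n p N : ℕ}

theorem measureReal_unfinished_eq_zero (h : ¬ T < N) :
    P.real {ω | Unfinished T rule (fun j => X j ω) n p N} = 0 := by
  have hempty : {ω | Unfinished T rule (fun j => X j ω) n p N} = ∅ :=
    Set.eq_empty_of_forall_notMem fun ω hω => h (Unfinished.lt hω)
  rw [hempty, measureReal_empty]

theorem measureReal_unfinished_succ_le [IsFiniteMeasure P] (t : ℕ) :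
    P.real {ω | Unfinished T rule (fun j => X j ω) (n + 1) p N} ≤
      P.real {ω | ∃ m ∈ Set.Iio t, (rule N).EndsAt (fun j => X j ω) p m ∧
        Unfinished T rule (fun j => X j ω) n (p + m) (N - m)} +
      P.real {ω | ∃ m ∈ Set.Ici t, (rule N).EndsAt (fun j => X j ω) p m ∧
        Unfinished T rule (fun j => X j ω) n (p + m) (N - m)} := by
  refine (measureReal_mono ?_).trans (measureReal_union_le _ _)
  rintro ω ⟨_, m, hm⟩
  exact (lt_or_ge m t).imp (fun hmt => ⟨m, hmt, hm⟩) fun hmt => ⟨m, hmt, hm⟩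

end UnfinishedMeasure

namespace IsItemStream

variable {Ω : Type*} [MeasurableSpace Ω] {P : Measure Ω} [IsProbabilityMeasure P]

/-- The strong Markov property, as a bound: `A i` is decided by the first `q i` items, `B i` by the
items after these. -/
theorem measureReal_iUnion_inter_le {ι κ : Type*} [MeasurableSpace ι] [Countable κ]
    {X : ℕ → Ω → ι} {μ : ι → ℝ} (h : IsItemStream P X μ) (q : κ → ℕ) {A B : κ → Set Ω}
    (hA : ∀ i, MeasurableSet[itemAlgebra X (Set.Iio (q i))] (A i))
    (hB : ∀ i, MeasurableSet[itemAlgebra X (Set.Ici (q i))] (B i))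
    (hdisj : Pairwise (Function.onFun Disjoint A)) {b : ℝ} (hb : 0 ≤ b)
    (hPB : ∀ i, P.real (B i) ≤ b) :
    P.real (⋃ i, A i ∩ B i) ≤ b * P.real (⋃ i, A i) := by
  have hle : P (⋃ i, A i ∩ B i) ≤ ENNReal.ofReal b * P (⋃ i, A i) := by
    rw [measure_iUnion hdisj fun i => h.itemAlgebra_le _ _ (hA i), ← ENNReal.tsum_mul_left]
    refine (measure_iUnion_le _).trans (ENNReal.tsum_le_tsum fun i => ?_)
    have hpast : Disjoint (Set.Iio (q i)) (Set.Ici (q i)) := Set.Iio_disjoint_Ici le_rfl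
    have hindep := h.measureReal_inter hpast (hA i) (hB i)
    rw [← ofReal_measureReal, ← ofReal_measureReal (s := A i), hindep, mul_comm,
      ENNReal.ofReal_mul measureReal_nonneg]
    exact mul_le_mul_left (ENNReal.ofReal_le_ofReal (hPB i)) _
  have hlt : ENNReal.ofReal b * P (⋃ i, A i) ≠ ⊤ :=
    ENNReal.mul_ne_top ENNReal.ofReal_ne_top (measure_ne_top _ _)
  simpa [hb, measureReal_def] using ENNReal.toReal_mono hlt hle

variable {k : ℕ} {X : ℕ → Ω → Fin k} {μ : Fin k → ℝ}

theorem measureReal_exists_endsAt_and_unfinished_le (h : IsItemStream P X μ) (R : RoundRule k)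
    (M : Set ℕ) {T : ℝ} {rule : ℕ → RoundRule k} {n p N : ℕ} {b : ℝ}
    (hb : 0 ≤ b)
    (hPb : ∀ m ∈ M, P.real {ω | Unfinished T rule (fun j => X j ω) n (p + m) (N - m)} ≤ b) :
    P.real {ω | ∃ m ∈ M, R.EndsAt (fun j => X j ω) p m ∧
      Unfinished T rule (fun j => X j ω) n (p + m) (N - m)} ≤
      b * P.real {ω | ∃ m ∈ M, R.EndsAt (fun j => X j ω) p m} := by
  have hmarkov := h.measureReal_iUnion_inter_le (κ := M) (fun m => p + m)
    (fun m => measurableSet_endsAt R p m Set.Ico_subset_Iio_self)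
    (fun m => measurableSet_unfinished T rule n (p + m) (N - m))
    (fun m m' hne => Set.disjoint_left.2 fun _ hm hm' => hne (Subtype.ext (hm.unique hm')))
    hb (fun m => hPb m m.2)
  convert hmarkov using 3 <;> ext ω <;> simp [and_left_comm]

/-- The weight argument: `t` items suffice to shrink the weight `W` of the threshold by the factor
`κ`, and a round collects fewer than `t` items with probability at most `f`. -/
theorem measureReal_unfinished_le (h : IsItemStream P X μ) {T : ℝ} {rule : ℕ → RoundRule k}
    {N₀ : ℕ} {W : ℕ → ℝ} {f κ : ℝ} (hf : 0 ≤ f) (hκ : 0 ≤ κ)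
    (hWone : ∀ N : ℕ, T < N → N ≤ N₀ → 1 ≤ W N)
    (hWmono : ∀ N N' : ℕ, T < N' → N' ≤ N → N ≤ N₀ → W N' ≤ W N)
    (hstep : ∀ N : ℕ, T < N → N ≤ N₀ → ∃ t : ℕ, (T < (N - t : ℕ) → W (N - t) ≤ κ * W N) ∧
      ∀ p, P.real {ω | ∃ m < t, (rule N).EndsAt (fun j => X j ω) p m} ≤ f)
    (n p N : ℕ) (hT : T < N) (hN : N ≤ N₀) :
    P.real {ω | Unfinished T rule (fun j => X j ω) n p N} ≤ (f + κ) ^ n * W N := by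
  induction n generalizing p N with
  | zero => simpa using measureReal_le_one.trans (hWone N hT hN)
  | succ n ih =>
    obtain ⟨t, hshrink, hfail⟩ := hstep N hT hN
    have hWN : 0 ≤ W N := zero_le_one.trans (hWone N hT hN)
    have hrest : ∀ m (b : ℝ), 0 ≤ b → (T < (N - m : ℕ) → W (N - m) ≤ b) →
        P.real {ω | Unfinished T rule (fun j => X j ω) n (p + m) (N - m)} ≤ (f + κ) ^ n * b := by
      intro m b hb hm
      by_cases hTm : T < (N - m : ℕ)
      · exact (ih _ _ hTm (by omega)).trans
          (mul_le_mul_of_nonneg_left (hm hTm) (by positivity))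
      · rw [measureReal_unfinished_eq_zero hTm]
        positivity
    have hfew := h.measureReal_exists_endsAt_and_unfinished_le (rule N) (Set.Iio t)
      (b := (f + κ) ^ n * W N) (by positivity)
      fun m _ => hrest m (W N) hWN fun hTm => hWmono _ _ hTm (Nat.sub_le _ _) hN
    have hmany := h.measureReal_exists_endsAt_and_unfinished_le (rule N) (Set.Ici t)
      (b := (f + κ) ^ n * (κ * W N)) (by positivity)
      fun m hm => hrest m (κ * W N) (by positivity) fun hTm => by
        have hle : N - m ≤ N - t := Nat.sub_le_sub_left hm N
        have hTt : T < (N - t : ℕ) := hTm.trans_le (by exact_mod_cast hle)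
        exact (hWmono _ _ hTm hle (by omega)).trans (hshrink hTt)
    calc P.real {ω | Unfinished T rule (fun j => X j ω) (n + 1) p N}
        ≤ _ := measureReal_unfinished_succ_le t
      _ ≤ (f + κ) ^ n * W N * f + (f + κ) ^ n * (κ * W N) * 1 :=
          add_le_add (hfew.trans (mul_le_mul_of_nonneg_left (hfail p) (by positivity)))
            (hmany.trans (mul_le_mul_of_nonneg_left measureReal_le_one (by positivity)))
      _ = (f + κ) ^ (n + 1) * W N := by ring

end IsItemStream

/-! ### Termination and cost of the runs -/

section CMY

variable {k : ℕ} {a : ℕ → Fin k} {p m N : ℕ}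

theorem exists_cmyRule_endsAt (hk : 0 < k) (hN : 2 * k ≤ N) (a : ℕ → Fin k) (p : ℕ) :
    ∃ m, (cmyRule k N).EndsAt a p m :=
  RoundRule.exists_endsAt hk ⟨k * (N / (2 * k)), fun _ _ hn =>
    (Nat.le_div_iff_mul_le (Nat.div_pos hN (by omega))).2 hn⟩ a p

theorem le_of_cmyRule_endsAt (h : (cmyRule k N).EndsAt a p m) : k * (N / (2 * k)) ≤ m := by
  have hnotified : k ≤ ∑ i, counter a p m i / (N / (2 * k)) := (RoundRule.endsAt_iff.1 h).1
  calc k * (N / (2 * k)) ≤ (∑ i, counter a p m i / (N / (2 * k))) * (N / (2 * k)) := by gcongr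
    _ ≤ ∑ i, counter a p m i := by
        rw [Finset.sum_mul]
        exact Finset.sum_le_sum fun i _ => Nat.div_mul_le_self _ _
    _ = m := sum_counter a p m

theorem le_three_mul_of_cmyRule_endsAt (hk : 0 < k) (hN : 4 * k ≤ N)
    (h : (cmyRule k N).EndsAt a p m) : N ≤ 3 * m := by
  have hslack : 2 ≤ N / (2 * k) := (Nat.le_div_iff_mul_le (by omega)).2 (by omega)
  have hlt : N < 2 * k * (N / (2 * k) + 1) := Nat.lt_mul_div_succ N (by omega)
  have := le_of_cmyRule_endsAt h
  nlinarith

theorem cmyRule_endsAt_le (hk : 0 < k) (hN : 2 * k ≤ N) (h : (cmyRule k N).EndsAt a p m) :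
    m ≤ N := by
  cases m with
  | zero => exact Nat.zero_le _
  | succ m =>
    have : Nonempty (Fin k) := ⟨⟨0, hk⟩⟩
    set s := N / (2 * k)
    have hspos : 0 < s := Nat.div_pos hN (by omega)
    have hnotified : ∑ i, counter a p m i / s < k :=
      (RoundRule.endsAt_iff.1 h).2 m (Nat.lt_succ_self m)
    refine Nat.succ_le_of_lt ?_
    calc m = ∑ i, counter a p m i := (sum_counter a p m).symm
      _ < ∑ i : Fin k, (counter a p m i / s + 1) * s :=
          Finset.sum_lt_sum_of_nonempty Finset.univ_nonempty fun i _ => by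
            rw [mul_comm]
            exact Nat.lt_mul_div_succ _ hspos
      _ = (∑ i : Fin k, counter a p m i / s) * s + k * s := by
          simp [← Finset.sum_mul, Finset.sum_add_distrib, add_mul]
      _ ≤ k * s + k * s := by gcongr
      _ = 2 * k * s := by ring
      _ ≤ N := Nat.mul_div_le N (2 * k)

theorem exists_cmyRun_of_lt_four_mul (hN : N < 4 * k) (a : ℕ → Fin k) (p : ℕ) :
    ∃ c, CMYRun a p N c ∧ c ≤ 5 * k := by
  rcases Nat.eq_zero_or_pos N with rfl | hpos
  · exact ⟨0, .alarm p, Nat.zero_le _⟩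
  · exact ⟨_, .direct p N hpos hN, by unfold directCost; omega⟩

theorem exists_cmyRun (hk : 0 < k) (a : ℕ → Fin k) (j p N : ℕ)
    (hN : (N : ℝ) < 4 * k * (3 / 2) ^ j) : ∃ c, CMYRun a p N c ∧ c ≤ 4 * k * j + 5 * k := by
  induction j generalizing p N with
  | zero =>
    rw [pow_zero, mul_one] at hN
    simpa using exists_cmyRun_of_lt_four_mul (by exact_mod_cast hN) a p
  | succ j ih =>
    rcases lt_or_ge N (4 * k) with hlt | hge
    · obtain ⟨c, hc, hle⟩ := exists_cmyRun_of_lt_four_mul hlt a p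
      exact ⟨c, hc, hle.trans (Nat.le_add_left _ _)⟩
    obtain ⟨m, hm⟩ := exists_cmyRule_endsAt hk (by omega : 2 * k ≤ N) a p
    have hrest : ((N - m : ℕ) : ℝ) < 4 * k * (3 / 2) ^ j := by
      have hthird := le_three_mul_of_cmyRule_endsAt hk hge hm
      have hrest' : 3 * (N - m) ≤ 2 * N := by omega
      have : 3 * ((N - m : ℕ) : ℝ) ≤ 2 * N := by exact_mod_cast hrest'
      rw [pow_succ] at hN
      linarith
    obtain ⟨c, hc, hle⟩ := ih (p + m) (N - m) hrest
    refine ⟨_, .round p N m c hge hm hc, ?_⟩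
    simp only [RoundRule.cost, cmyRule]
    linarith

end CMY

section Framework

variable {k : ℕ} {β δ : ℝ} {rule : ℕ → RoundRule k} {a : ℕ → Fin k} {B : ℕ}

theorem exists_frameworkRun_of_le (hB : 5 * k ≤ B)
    (hcmy : ∀ p N : ℕ, (N : ℝ) ≤ β * (k * Real.log (k / δ)) → ∃ c, CMYRun a p N c ∧ c ≤ B)
    (p N : ℕ) (hN : (N : ℝ) ≤ β * (k * Real.log (k / δ))) :
    ∃ c, FrameworkRun β δ rule a p N c ∧ c ≤ B := by
  rcases Nat.eq_zero_or_pos N with rfl | hpos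
  · exact ⟨0, .alarm p, Nat.zero_le _⟩
  rcases le_or_gt N (4 * k) with hle | hgt
  · exact ⟨_, .direct p N hpos hle, by unfold directCost; omega⟩
  · obtain ⟨c, hc, hcB⟩ := hcmy p N hN
    exact ⟨c, .cmy p N c hgt hN hc, hcB⟩

theorem exists_frameworkRun_of_not_unfinished (hβ : (4 * k : ℝ) ≤ β * (k * Real.log (k / δ)))
    (hrule : ∀ N : ℕ, β * (k * Real.log (k / δ)) < N → ∀ p, ∃ m, (rule N).EndsAt a p m)
    (hcost : ∀ N : ℕ, (rule N).cost ≤ 4 * k) (hB : 5 * k ≤ B)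
    (hcmy : ∀ p N : ℕ, (N : ℝ) ≤ β * (k * Real.log (k / δ)) → ∃ c, CMYRun a p N c ∧ c ≤ B)
    (n p N : ℕ) (h : ¬ Unfinished (β * (k * Real.log (k / δ))) rule a n p N) :
    ∃ c, FrameworkRun β δ rule a p N c ∧ c ≤ 4 * k * n + B := by
  induction n generalizing p N with
  | zero => simpa using exists_frameworkRun_of_le hB hcmy p N (not_lt.1 h)
  | succ n ih =>
    rcases le_or_gt (N : ℝ) (β * (k * Real.log (k / δ))) with hN | hN
    · obtain ⟨c, hc, hle⟩ := exists_frameworkRun_of_le hB hcmy p N hN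
      exact ⟨c, hc, hle.trans (Nat.le_add_left _ _)⟩
    obtain ⟨m, hm⟩ := hrule N hN p
    obtain ⟨c, hc, hle⟩ := ih _ _ fun hu => h ⟨hN, m, hm, hu⟩
    refine ⟨_, .round p N m c (by exact_mod_cast hβ.trans_lt hN) hN hm hc, ?_⟩
    linarith [hcost N]

end Framework

/-! ### The estimates of the learning round -/

theorem sum_sqrt_le_sqrt_card_mul_sum {ι : Type*} (s : Finset ι) {c : ι → ℝ}
    (hc : ∀ i, 0 ≤ c i) : ∑ i ∈ s, √(c i) ≤ √(s.card * ∑ i ∈ s, c i) := by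
  have hcs := Real.sum_sqrt_mul_sqrt_le s hc (g := fun _ => (1 : ℝ)) fun _ => zero_le_one
  simp only [Real.sqrt_one, mul_one, Finset.sum_const, nsmul_eq_mul] at hcs
  rwa [← Real.sqrt_mul (Finset.sum_nonneg fun i _ => hc i), mul_comm] at hcs

theorem sqrt_two_gt : (1.414 : ℝ) < √2 := Real.lt_sqrt_of_sq_lt (by norm_num)

theorem sqrt_two_lt : √2 < (1.415 : ℝ) := (Real.sqrt_lt' (by norm_num)).2 (by norm_num)

theorem le_learnBeta : 84 ≤ learnBeta := by
  unfold learnBeta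
  nlinarith [sqrt_two_gt]

/-- The conditions on the number of players and the failure probability. -/
structure Admissible (k : ℕ) (δ : ℝ) : Prop where
  pos : 0 < δ
  lt_one : δ < 1
  two_le_div : 2 ≤ (k : ℝ) / δ

namespace Admissible

variable {k : ℕ} {δ : ℝ}

theorem k_pos (h : Admissible k δ) : 0 < k := by
  refine Nat.pos_of_ne_zero fun hk => ?_
  have := h.two_le_div
  norm_num [hk] at this

theorem one_le_k (h : Admissible k δ) : (1 : ℝ) ≤ k := by exact_mod_cast h.k_pos

theorem le_log (h : Admissible k δ) : 0.693 ≤ Real.log (k / δ) := by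
  refine le_trans ?_ (Real.log_le_log two_pos h.two_le_div)
  linarith [Real.log_two_gt_d9]

theorem log_pos (h : Admissible k δ) : 0 < Real.log (k / δ) := by linarith [h.le_log]

theorem exp_neg_log (h : Admissible k δ) : Real.exp (-Real.log (k / δ)) = δ / k := by
  rw [Real.exp_neg, Real.exp_log (by linarith [h.two_le_div]), inv_div]

theorem log_three_div_le (h : Admissible k δ) : Real.log (3 / δ) ≤ 3 * Real.log (k / δ) := by
  have hδ := h.pos
  have htwo := h.two_le_div
  rw [show (3 : ℝ) * Real.log (k / δ) = Real.log ((k / δ) ^ 3) by rw [Real.log_pow]; norm_num]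
  refine Real.log_le_log (by positivity) ?_
  calc 3 / δ ≤ k / δ * 3 := by
        rw [div_mul_eq_mul_div]
        gcongr
        linarith [h.one_le_k]
    _ ≤ (k / δ) ^ 3 := by nlinarith [mul_le_mul htwo htwo zero_le_two (by linarith)]

theorem log_three_div_nonneg (h : Admissible k δ) : 0 ≤ Real.log (3 / δ) :=
  Real.log_nonneg ((one_le_div h.pos).2 (by linarith [h.lt_one]))

theorem le_mul_log (h : Admissible k δ) : 0.693 * k ≤ k * Real.log (k / δ) := by
  rw [mul_comm]
  exact mul_le_mul_of_nonneg_left h.le_log (Nat.cast_nonneg k)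

theorem mul_log_pos (h : Admissible k δ) : 0 < k * Real.log (k / δ) :=
  mul_pos (by exact_mod_cast h.k_pos) h.log_pos

theorem mul_log_lt (h : Admissible k δ) {N : ℕ} (hN : learnBeta * (k * Real.log (k / δ)) < N) :
    84 * (k * Real.log (k / δ)) < N :=
  (mul_le_mul_of_nonneg_right le_learnBeta h.mul_log_pos.le).trans_lt hN

theorem sqrt_mul_log_le (h : Admissible k δ) {N : ℕ}
    (hN : learnBeta * (k * Real.log (k / δ)) < N) : 9.16 * √(k * Real.log (k / δ)) ≤ √N := by
  refine Real.le_sqrt_of_sq_le ?_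
  rw [mul_pow, Real.sq_sqrt h.mul_log_pos.le]
  linarith [h.mul_log_lt hN, h.mul_log_pos]

end Admissible

/-- The counters `n` of the learning round, played with the threshold `N₀`, are such that no player
with a noticeable share of the items is severely underestimated. -/
structure GoodSample {k : ℕ} (δ : ℝ) (N₀ : ℕ) (μ : Fin k → ℝ) (n : Fin k → ℕ) : Prop
    extends Admissible k δ where
  large : learnBeta * (k * Real.log (k / δ)) < N₀
  nonneg : ∀ i, 0 ≤ μ i
  sum_eq_one : ∑ i, μ i = 1
  two_fifths_le_total : 2 / 5 * N₀ ≤ total n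
  mul_total_le : ∀ i,
    μ i * total n ≤ n i + 3 * √(μ i * N₀ * Real.log (k / δ)) + 3 * Real.log (k / δ)

theorem target_eq {k : ℕ} {δ : ℝ} {n : Fin k → ℕ} (hσ : 0 ≤ sigmaHat δ n) (N : ℕ) :
    target δ n N = N * (√(sigmaHat δ n))⁻¹ ^ 2 -
      (√2 + 2 / 3) * (√(k * Real.log (k / δ)) * √N * (√(sigmaHat δ n))⁻¹) := by
  have hprod : (k : ℝ) * (N / sigmaHat δ n) * Real.log (k / δ) =
      N * (sigmaHat δ n)⁻¹ * (k * Real.log (k / δ)) := by ring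
  rw [target, hprod, Real.sqrt_mul (by positivity), Real.sqrt_mul (Nat.cast_nonneg N),
    Real.sqrt_inv, inv_pow, Real.sq_sqrt hσ]
  ring

theorem mul_sqrt_mul_le {x y N N₀ : ℝ} (hx : 0 ≤ x) (hxN : x ≤ N) (hN₀ : 0 < N₀) :
    x * √(N₀ * y) ≤ √(x * y) * √(N / N₀) * N₀ := by
  have hfactor : x * √(N₀ * y) = √(x * y) * √(x / N₀) * N₀ := by
    rw [Real.sqrt_mul hN₀.le, Real.sqrt_mul hx, Real.sqrt_div hx]
    linear_combination √y * √N₀ * (-Real.mul_self_sqrt hx) - √x * √x * √y * Real.div_sqrt (x := N₀)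
  rw [hfactor]
  gcongr

namespace GoodSample

variable {k N₀ : ℕ} {δ : ℝ} {μ : Fin k → ℝ} {n : Fin k → ℕ}

theorem N₀_pos (h : GoodSample δ N₀ μ n) : (0 : ℝ) < N₀ := by
  linarith [h.mul_log_lt h.large, h.mul_log_pos]

theorem total_pos (h : GoodSample δ N₀ μ n) : 0 < total n := by
  linarith [h.N₀_pos, h.two_fifths_le_total]

theorem sum_muBar (h : GoodSample δ N₀ μ n) : ∑ i, muBar n i = 1 := by
  unfold muBar
  rw [← Finset.sum_div]
  exact div_self h.total_pos.ne'

theorem muBar_nonneg (h : GoodSample δ N₀ μ n) (i : Fin k) : 0 ≤ muBar n i :=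
  div_nonneg (Nat.cast_nonneg _) h.total_pos.le

theorem muBar_le_muHat (h : GoodSample δ N₀ μ n) (i : Fin k) : muBar n i ≤ muHat δ n i := by
  have := h.log_three_div_nonneg
  have := h.total_pos
  rw [muHat, add_assoc]
  exact le_add_of_nonneg_right (by positivity)

theorem muHat_nonneg (h : GoodSample δ N₀ μ n) (i : Fin k) : 0 ≤ muHat δ n i :=
  (h.muBar_nonneg i).trans (h.muBar_le_muHat i)

theorem one_le_sigmaHat (h : GoodSample δ N₀ μ n) : 1 ≤ sigmaHat δ n :=
  h.sum_muBar ▸ Finset.sum_le_sum fun i _ => h.muBar_le_muHat i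

theorem sigmaHat_sub_one_eq (h : GoodSample δ N₀ μ n) : sigmaHat δ n - 1 =
    ∑ i, √(2 * (muBar n i - muBar n i ^ 2) * Real.log (3 / δ) / total n) +
      k * (3 * Real.log (3 / δ) / total n) := by
  simp only [sigmaHat, muHat, Finset.sum_add_distrib, h.sum_muBar, Finset.sum_const,
    Finset.card_univ, Fintype.card_fin, nsmul_eq_mul]
  ring

theorem log_three_div_div_total_le (h : GoodSample δ N₀ μ n) :
    Real.log (3 / δ) / total n ≤ 15 / 2 * (Real.log (k / δ) / N₀) := by
  have hN₀ := h.N₀_pos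
  calc Real.log (3 / δ) / total n ≤ 3 * Real.log (k / δ) / (2 / 5 * N₀) := by
        gcongr
        · linarith [h.log_pos]
        · exact h.log_three_div_le
        · exact h.two_fifths_le_total
    _ = 15 / 2 * (Real.log (k / δ) / N₀) := by ring

theorem sum_sqrt_muBar_le (h : GoodSample δ N₀ μ n) :
    ∑ i, √(2 * (muBar n i - muBar n i ^ 2) * Real.log (3 / δ) / total n) ≤
      √(15 * (k * Real.log (k / δ)) / N₀) := by
  have := h.total_pos
  have := h.log_three_div_nonneg
  calc ∑ i, √(2 * (muBar n i - muBar n i ^ 2) * Real.log (3 / δ) / total n)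
      ≤ ∑ i, √(2 * muBar n i * Real.log (3 / δ) / total n) := by
        gcongr with i
        linarith [sq_nonneg (muBar n i)]
    _ ≤ √(k * ∑ i, 2 * muBar n i * Real.log (3 / δ) / total n) := by
        refine (sum_sqrt_le_sqrt_card_mul_sum _ fun i => ?_).trans_eq (by simp)
        have := h.muBar_nonneg i
        positivity
    _ = √(k * (2 * (Real.log (3 / δ) / total n))) := by
        simp only [mul_div_assoc, ← Finset.sum_mul, ← Finset.mul_sum, h.sum_muBar, one_mul,
          mul_assoc]
    _ ≤ √(k * (2 * (15 / 2 * (Real.log (k / δ) / N₀)))) := by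
        gcongr
        exact h.log_three_div_div_total_le
    _ = √(15 * (k * Real.log (k / δ)) / N₀) := by ring_nf

theorem sigmaHat_sub_one_le (h : GoodSample δ N₀ μ n) :
    (sigmaHat δ n - 1) * √N₀ ≤ 7 * √(k * Real.log (k / δ)) := by
  have hN₀ := h.N₀_pos
  have hsqrtN₀ : 0 < √(N₀ : ℝ) := Real.sqrt_pos.2 hN₀
  have hkL := h.mul_log_pos
  have hlinear : k * (3 * Real.log (3 / δ) / total n) ≤ 45 / 2 * (k * Real.log (k / δ) / N₀) := by
    rw [mul_div_assoc 3]
    calc _ ≤ k * (3 * (15 / 2 * (Real.log (k / δ) / N₀))) := by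
          gcongr
          exact h.log_three_div_div_total_le
      _ = _ := by ring
  have hroot : √(15 * (k * Real.log (k / δ)) / N₀) ≤ 3.88 * √(k * Real.log (k / δ)) / √N₀ := by
    rw [Real.sqrt_div (by positivity), Real.sqrt_mul (by norm_num)]
    gcongr
    exact Real.sqrt_le_iff.2 (by norm_num)
  have hratio : √(k * Real.log (k / δ)) / √N₀ ≤ 1 / 9.16 := by
    rw [div_le_div_iff₀ hsqrtN₀ (by norm_num)]
    linarith [h.sqrt_mul_log_le h.large]
  calc (sigmaHat δ n - 1) * √N₀
      ≤ (3.88 * √(k * Real.log (k / δ)) / √N₀ + 45 / 2 * (k * Real.log (k / δ) / N₀)) * √N₀ := by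
        rw [h.sigmaHat_sub_one_eq]
        gcongr
        exact h.sum_sqrt_muBar_le.trans hroot
    _ = 3.88 * √(k * Real.log (k / δ)) +
          45 / 2 * √(k * Real.log (k / δ)) * (√(k * Real.log (k / δ)) / √N₀) := by
        have hsq : k * Real.log (k / δ) / N₀ = (√(k * Real.log (k / δ)) / √N₀) ^ 2 := by
          rw [div_pow, Real.sq_sqrt hkL.le, Real.sq_sqrt hN₀.le]
        rw [hsq]
        field_simp
    _ ≤ 3.88 * √(k * Real.log (k / δ)) + 45 / 2 * √(k * Real.log (k / δ)) * (1 / 9.16) := by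
        gcongr
    _ ≤ 7 * √(k * Real.log (k / δ)) := by linarith [Real.sqrt_nonneg (k * Real.log (k / δ))]

theorem inv_sqrt_sigmaHat_le_one (h : GoodSample δ N₀ μ n) : (√(sigmaHat δ n))⁻¹ ≤ 1 :=
  inv_le_one_of_one_le₀ (Real.one_le_sqrt.2 h.one_le_sigmaHat)

theorem le_inv_sqrt_sigmaHat (h : GoodSample δ N₀ μ n) : 0.75 ≤ (√(sigmaHat δ n))⁻¹ := by
  have hpos : 0 < √(k * Real.log (k / δ)) := Real.sqrt_pos.2 h.mul_log_pos
  have hσ : sigmaHat δ n - 1 ≤ 0.77 := by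
    by_contra! hσ
    nlinarith [h.sigmaHat_sub_one_le, h.sqrt_mul_log_le h.large]
  have hsqrt : √(sigmaHat δ n) ≤ 4 / 3 := Real.sqrt_le_iff.2 ⟨by norm_num, by linarith⟩
  refine le_trans (by norm_num) (inv_anti₀ (Real.sqrt_pos.2 ?_) hsqrt)
  linarith [h.one_le_sigmaHat]

theorem one_sub_inv_sigmaHat_le (h : GoodSample δ N₀ μ n) {N : ℕ} (hNN₀ : N ≤ N₀) :
    (1 - (√(sigmaHat δ n))⁻¹ ^ 2) * √N ≤ 7 * √(k * Real.log (k / δ)) := by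
  have hσ := h.one_le_sigmaHat
  rw [inv_pow, Real.sq_sqrt (by linarith)]
  refine le_trans ?_ h.sigmaHat_sub_one_le
  have hinv : 1 - (sigmaHat δ n)⁻¹ ≤ sigmaHat δ n - 1 := by
    linarith [Real.one_sub_inv_le_log_of_pos (x := sigmaHat δ n) (by linarith),
      Real.log_le_sub_one_of_pos (x := sigmaHat δ n) (by linarith)]
  gcongr

variable {N : ℕ}

theorem third_le_target (h : GoodSample δ N₀ μ n)
    (hN : learnBeta * (k * Real.log (k / δ)) < N) : N / 3 ≤ target δ n N := by
  rw [target_eq (by linarith [h.one_le_sigmaHat])]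
  have hy := h.sqrt_mul_log_le hN
  have hu := h.le_inv_sqrt_sigmaHat
  have hdev : (√2 + 2 / 3) * √(k * Real.log (k / δ)) ≤ 0.23 * √N := by
    nlinarith [sqrt_two_lt, Real.sqrt_nonneg (k * Real.log (k / δ))]
  set u := (√(sigmaHat δ n))⁻¹
  calc (N : ℝ) / 3 ≤ N * (u ^ 2 - 0.23 * u) := by
        rw [div_eq_mul_one_div]
        gcongr
        nlinarith
    _ = N * u ^ 2 - 0.23 * √N * (√N * u) := by
        linear_combination (0.23 * u) * Real.mul_self_sqrt (Nat.cast_nonneg (α := ℝ) N)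
    _ ≤ N * u ^ 2 - (√2 + 2 / 3) * √(k * Real.log (k / δ)) * (√N * u) := by gcongr
    _ = _ := by ring

theorem sub_target_le (h : GoodSample δ N₀ μ n) (hNN₀ : N ≤ N₀) :
    N - target δ n N ≤ 9.1 * (√(k * Real.log (k / δ)) * √N) := by
  rw [target_eq (by linarith [h.one_le_sigmaHat])]
  have hu := mul_le_mul_of_nonneg_right (h.one_sub_inv_sigmaHat_le hNN₀) (Real.sqrt_nonneg N)
  have hdev : (√2 + 2 / 3) * (√(k * Real.log (k / δ)) * √N * (√(sigmaHat δ n))⁻¹) ≤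
      2.1 * (√(k * Real.log (k / δ)) * √N * 1) := by
    gcongr
    · linarith [sqrt_two_lt]
    · exact h.inv_sqrt_sigmaHat_le_one
  rw [mul_assoc _ √(N : ℝ), Real.mul_self_sqrt (Nat.cast_nonneg N)] at hu
  linarith

theorem le_sub_target (h : GoodSample δ N₀ μ n)
    (hN : learnBeta * (k * Real.log (k / δ)) < N) :
    2.08 * (√(k * Real.log (k / δ)) * √N) ≤ N - target δ n N := by
  rw [target_eq (by linarith [h.one_le_sigmaHat])]
  have hy := h.sqrt_mul_log_le hN
  have hu := h.le_inv_sqrt_sigmaHat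
  have hu1 := h.inv_sqrt_sigmaHat_le_one
  have hN2 := Real.mul_self_sqrt (Nat.cast_nonneg (α := ℝ) N)
  set u := (√(sigmaHat δ n))⁻¹
  set y := √(k * Real.log (k / δ))
  have hy0 : 0 ≤ y := Real.sqrt_nonneg _
  have hcoef : 2.08 * (y * √N) ≤ (√2 + 2 / 3) * (y * √N) := by
    gcongr
    linarith [sqrt_two_gt]
  have hc : (√2 + 2 / 3) * y ≤ 2.1 * y := by
    gcongr
    linarith [sqrt_two_lt]
  have hgap : 0 ≤ √N * (1 - u) * (√N * (1 + u) - (√2 + 2 / 3) * y) := by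
    refine mul_nonneg (mul_nonneg (Real.sqrt_nonneg N) (by linarith)) ?_
    nlinarith [Real.sqrt_nonneg (N : ℝ)]
  linear_combination hcoef + hgap + (1 - u ^ 2) * hN2

theorem target_pos (h : GoodSample δ N₀ μ n)
    (hN : learnBeta * (k * Real.log (k / δ)) < N) : 0 < target δ n N := by
  linarith [h.third_le_target hN, h.mul_log_lt hN, h.mul_log_pos]

theorem target_le (h : GoodSample δ N₀ μ n)
    (hN : learnBeta * (k * Real.log (k / δ)) < N) : target δ n N ≤ N := by
  have := h.le_sub_target hN
  have : 0 ≤ √(k * Real.log (k / δ)) * √N := by positivity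
  linarith

theorem mul_le_of_le (h : GoodSample δ N₀ μ n) {t : ℝ} (ht : 0 ≤ t) (htN : t ≤ N) (i : Fin k) :
    μ i * t ≤ muHat δ n i * t + 8 * √(N / N₀) * √(μ i * t * Real.log (k / δ)) +
      8 * √(N / N₀) ^ 2 * Real.log (k / δ) := by
  rw [Real.sq_sqrt (by positivity : (0 : ℝ) ≤ N / N₀)]
  have hL := h.log_pos
  have hN₀ := h.N₀_pos
  have htotal := h.total_pos
  have hscaled : μ i * t ≤ muBar n i * t +
      3 * (t * √(μ i * N₀ * Real.log (k / δ))) / total n +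
      3 * (t * Real.log (k / δ)) / total n := by
    have := mul_le_mul_of_nonneg_left (h.mul_total_le i) (div_nonneg ht htotal.le)
    unfold muBar
    field_simp at this ⊢
    linarith
  have hbar : muBar n i * t ≤ muHat δ n i * t :=
    mul_le_mul_of_nonneg_right (h.muBar_le_muHat i) ht
  have hroot : 3 * (t * √(μ i * N₀ * Real.log (k / δ))) / total n ≤
      15 / 2 * √(N / N₀) * √(μ i * t * Real.log (k / δ)) := by
    calc _ ≤ 3 * (√(μ i * t * Real.log (k / δ)) * √(N / N₀) * N₀) / (2 / 5 * N₀) := by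
          have hswap := mul_sqrt_mul_le (y := μ i * Real.log (k / δ)) ht htN hN₀
          rw [mul_left_comm, ← mul_assoc, mul_left_comm t, ← mul_assoc] at hswap
          gcongr
          exact h.two_fifths_le_total
      _ = _ := by
          field_simp
          ring
  have hlinear : 3 * (t * Real.log (k / δ)) / total n ≤ 15 / 2 * (N / N₀ * Real.log (k / δ)) := by
    calc _ ≤ 3 * (N * Real.log (k / δ)) / (2 / 5 * N₀) := by
          gcongr
          exact h.two_fifths_le_total
      _ = _ := by
          field_simp
          ring
  have : 0 ≤ √(N / N₀ : ℝ) * √(μ i * t * Real.log (k / δ)) := by positivity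
  have : 0 ≤ (N / N₀ : ℝ) * Real.log (k / δ) := by positivity
  linarith

end GoodSample

/-! ### Tails of a counter against an estimated static slack -/

section EstimatedSlack

variable {q τ h L ρ s : ℝ} {m : ℕ}

theorem half_sub_le_of_le_add (hτ : 0 ≤ τ) (hL : 0 ≤ L) (hρ0 : 0 ≤ ρ) (hρ1 : ρ ≤ 1)
    (hτh : τ ≤ h + 8 * ρ * √(τ * L) + 8 * ρ ^ 2 * L) : τ / 2 - 40 * L ≤ h := by
  have hroot : √(τ * L) ≤ τ / 16 + 4 * L := by
    refine Real.sqrt_le_iff.2 ⟨by positivity, ?_⟩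
    nlinarith [sq_nonneg (τ / 16 - 4 * L)]
  have hlin : 8 * ρ * √(τ * L) ≤ 8 * 1 * √(τ * L) := by gcongr
  have hsq : 8 * ρ ^ 2 * L ≤ 8 * 1 ^ 2 * L := by gcongr
  linarith

theorem exp_neg_two_mul_le (hL : 0.693 ≤ L) : Real.exp (-(2 * L)) ≤ 0.99 * Real.exp (-L) := by
  rw [two_mul, neg_add, Real.exp_add]
  gcongr
  exact exp_neg_le_of_le (by linarith)

theorem binTail_le_of_mul_le_fraction (hq0 : 0 ≤ q) (hq1 : q ≤ 1) (hL : 0 ≤ L) (hh : 0 ≤ h)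
    (hρ0 : 0 ≤ ρ) (hρ1 : ρ ≤ 1) (hτ : 0 ≤ τ)
    (hτh : τ ≤ h + 8 * ρ * √(τ * L) + 8 * ρ ^ 2 * L)
    (hm : m * q ≤ τ / 10000) (hs : h + 2 / 3 * L ≤ s) : binTail q m s ≤ Real.exp (-(2 * L)) := by
  refine (binTail_le_exp_neg_four_mul_add hq0 hq1 hm s).trans (Real.exp_le_exp.2 ?_)
  have := half_sub_le_of_le_add hτ hL hρ0 hρ1 hτh
  rcases le_total τ (88 * L) with _ | _ <;> linarith

theorem le_nine_mul_sqrt_mul (hL : 0 ≤ L) (hLτ : L ≤ 81 * τ) : L ≤ 9 * √(τ * L) := by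
  rw [show (9 : ℝ) = √(9 ^ 2) by rw [Real.sqrt_sq (by norm_num)], ← Real.sqrt_mul (by norm_num)]
  exact Real.le_sqrt_of_sq_le (by nlinarith)

theorem add_sqrt_two_mul_le_slack (hL : 0 < L) (hLτ : L ≤ 81 * τ) (hρ0 : 0 ≤ ρ)
    (hρ : ρ ≤ 1 / 1000000) (hτh : τ ≤ h + 8 * ρ * √(τ * L) + 8 * ρ ^ 2 * L) :
    τ + √2 * √(τ * L) - 9 * (ρ * √(τ * L)) - 13 * (ρ * L) ≤ h + √(2 * h * L) := by
  have hLx := le_nine_mul_sqrt_mul hL.le hLτ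
  have hx2 : √(τ * L) ^ 2 = τ * L := Real.sq_sqrt (mul_nonneg (by linarith) hL.le)
  set x := √(τ * L)
  have hρL : ρ * L ≤ 1 / 1000000 * (9 * x) := by gcongr
  have hh : τ - 9 * (ρ * x) ≤ h := by
    have : ρ * (ρ * L) ≤ ρ * (1 / 1000000 * (9 * x)) := by gcongr
    nlinarith [mul_nonneg hρ0 (by linarith : 0 ≤ x)]
  have hroot : x - 9 * (ρ * L) ≤ √(h * L) := by
    refine Real.le_sqrt_of_sq_le ?_
    have hhL : (τ - 9 * (ρ * x)) * L ≤ h * L := by gcongr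
    have : 0 ≤ ρ * L * (x - 9 * (ρ * L)) := mul_nonneg (by positivity) (by linarith)
    linear_combination hhL + 9 * this + hx2
  have hsqrt2 : √2 * (9 * (ρ * L)) ≤ 13 * (ρ * L) := by
    have := mul_le_mul_of_nonneg_right sqrt_two_lt.le (mul_nonneg hρ0 hL.le)
    nlinarith [mul_nonneg hρ0 hL.le]
  have hmul := mul_le_mul_of_nonneg_left hroot (Real.sqrt_nonneg 2)
  rw [mul_assoc 2 h, Real.sqrt_mul (by norm_num)]
  linarith

theorem binTail_le_of_estimate_fine (hq0 : 0 ≤ q) (hq1 : q ≤ 1) (hL : 0.693 ≤ L)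
    (hLτ : L ≤ 81 * τ) (hρ : ρ ≤ 1 / 1000000) (hm : m * q ≤ τ)
    (hfine : 9 * (ρ * √(τ * L)) ≤ L / 24)
    (hs : τ + √2 * √(τ * L) - 9 * (ρ * √(τ * L)) - 13 * (ρ * L) + 2 / 3 * L ≤ s) :
    binTail q m s ≤ 0.99 * Real.exp (-L) := by
  refine binTail_le_bernstein_improved hq0 hq1 hm (by linarith) hL ?_
  have : ρ * L ≤ 1 / 1000000 * L := by gcongr
  rw [mul_assoc 2 τ, Real.sqrt_mul (by norm_num)]
  linarith

/-- An estimation error that is visible on the scale of `L` is at most a multiple of `ρ * τ`, so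
stopping at `(1 - 216 * ρ) * τ` leaves room for it and for doubling the exponent. -/
theorem binTail_le_of_estimate_coarse (hq0 : 0 ≤ q) (hq1 : q ≤ 1) (hL : 0 < L)
    (hLτ : L ≤ 81 * τ) (hρ0 : 0 ≤ ρ) (hρ : ρ ≤ 1 / 1000000) (hm : m * q ≤ (1 - 216 * ρ) * τ)
    (hcoarse : L / 24 ≤ 9 * (ρ * √(τ * L)))
    (hs : τ + √2 * √(τ * L) - 9 * (ρ * √(τ * L)) - 13 * (ρ * L) + 2 / 3 * L ≤ s) :
    binTail q m s ≤ Real.exp (-(2 * L)) := by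
  have hτ : 0 < τ := by linarith
  have hLx := le_nine_mul_sqrt_mul hL.le hLτ
  have hx2 : √(τ * L) ^ 2 = τ * L := Real.sq_sqrt (by positivity)
  have hsqrt : √(2 * ((1 - 216 * ρ) * τ) * (2 * L)) ≤ 2 * √(τ * L) := by
    refine Real.sqrt_le_iff.2 ⟨by positivity, ?_⟩
    rw [mul_pow, hx2]
    have : 0 ≤ ρ * (τ * L) := by positivity
    linarith
  have hx0 : 0 < √(τ * L) := by positivity
  set x := √(τ * L)
  have hxτ : x ≤ 216 * (ρ * τ) := by
    refine le_of_mul_le_mul_right ?_ hx0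
    linear_combination hx2 + 24 * τ * hcoarse
  have hρL : ρ * L ≤ 1 / 1000000 * (9 * x) := by gcongr
  have hρx : ρ * x ≤ 1 / 1000000 * x := by gcongr
  have hsqrt2 : 1.414 * x ≤ √2 * x := by
    gcongr
    exact sqrt_two_gt.le
  refine binTail_le_bernstein hq0 hq1 hm (mul_pos (by linarith) hτ) (by positivity) ?_
  linarith

theorem binTail_le_of_near_target (hq0 : 0 ≤ q) (hq1 : q ≤ 1) (hL : 0.693 ≤ L) (hh : 0 ≤ h)
    (hρ0 : 0 ≤ ρ) (hρ : ρ ≤ 1 / 1000000) (hτ : 0 ≤ τ)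
    (hτh : τ ≤ h + 8 * ρ * √(τ * L) + 8 * ρ ^ 2 * L) (hm : m * q ≤ (1 - 216 * ρ) * τ)
    (hs : h + √(2 * h * L) + 2 / 3 * L ≤ s) : binTail q m s ≤ 0.99 * Real.exp (-L) := by
  have hL0 : 0 < L := by linarith
  have hmτ : m * q ≤ τ := hm.trans (mul_le_of_le_one_left hτ (by linarith))
  rcases le_total (81 * τ) L with hτL | hLτ
  · refine le_trans ?_ (exp_neg_two_mul_le hL)
    refine (binTail_le_exp_neg_four_mul_add hq0 hq1 hmτ s).trans (Real.exp_le_exp.2 ?_)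
    linarith [Real.sqrt_nonneg (2 * h * L)]
  have hslack := add_sqrt_two_mul_le_slack hL0 hLτ hρ0 hρ hτh
  rcases le_total (9 * (ρ * √(τ * L))) (L / 24) with hfine | hcoarse
  · exact binTail_le_of_estimate_fine hq0 hq1 hL hLτ hρ hmτ hfine (by linarith)
  · exact (binTail_le_of_estimate_coarse hq0 hq1 hL0 hLτ hρ0 hρ hm hcoarse (by linarith)).trans
      (exp_neg_two_mul_le hL)

end EstimatedSlack

/-! ### Rounds with learned slacks -/

section SlackRules

variable {k : ℕ} {a : ℕ → Fin k} {p m : ℕ}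

theorem exists_staticRule_endsAt (hk : 0 < k) (s : Fin k → ℝ) (a : ℕ → Fin k) (p : ℕ) :
    ∃ m, (staticRule s).EndsAt a p m := by
  refine RoundRule.exists_endsAt hk ⟨∑ i, ⌈s i⌉₊, fun i n hn => ?_⟩ a p
  have hs : ⌈s i⌉₊ ≤ n :=
    (Finset.single_le_sum (fun _ _ => Nat.zero_le _) (Finset.mem_univ i)).trans hn
  simp [staticRule, Nat.ceil_le.1 hs]

theorem exists_dynamicRule_endsAt (hk : 0 < k) (b : Fin k → ℝ) {s : ℕ} (hs : 0 < s)
    (a : ℕ → Fin k) (p : ℕ) : ∃ m, (dynamicRule b s).EndsAt a p m := by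
  refine RoundRule.exists_endsAt hk ⟨k * s + ∑ i, ⌈b i⌉₊, fun i n hn => ?_⟩ a p
  have hb : ⌈b i⌉₊ ≤ ∑ i, ⌈b i⌉₊ :=
    Finset.single_le_sum (f := fun i => ⌈b i⌉₊) (fun _ _ => Nat.zero_le _) (Finset.mem_univ i)
  have hn' : (k * s + ⌈b i⌉₊ : ℝ) ≤ n := by exact_mod_cast (by omega : k * s + ⌈b i⌉₊ ≤ n)
  refine Nat.le_floor ?_
  rw [le_div_iff₀ (by exact_mod_cast hs)]
  simp only [dynamicRule]
  linarith [Nat.le_ceil (b i)]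

theorem exists_le_counter_of_staticRule_endsAt {s : Fin k → ℝ}
    (h : (staticRule s).EndsAt a p m) : ∃ i, s i ≤ counter a p m i := by
  by_contra! hlt
  have hsent := (RoundRule.endsAt_iff.1 h).1
  simp [staticRule, (hlt _).not_ge] at hsent

theorem exists_le_sum_of_dynamicRule_endsAt (hk : 0 < k) {b : Fin k → ℝ} {s : ℕ} (hs : 0 < s)
    (h : (dynamicRule b s).EndsAt a p m) :
    ∃ A : Finset (Fin k), A.Nonempty ∧ (k * s : ℝ) ≤ ∑ i ∈ A, (counter a p m i - b i) := by
  have hs' : (0 : ℝ) < s := by exact_mod_cast hs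
  have hsent : (k : ℝ) ≤ ∑ i, (⌊(counter a p m i - b i) / s⌋₊ : ℝ) := by
    exact_mod_cast (RoundRule.endsAt_iff.1 h).1
  let A : Finset (Fin k) := {i | b i < counter a p m i}
  have hle : (k * s : ℝ) ≤ ∑ i ∈ A, (counter a p m i - b i) := by
    rw [← le_div_iff₀ hs', Finset.sum_div, Finset.sum_filter]
    refine hsent.trans (Finset.sum_le_sum fun i _ => ?_)
    split_ifs with hi
    · exact Nat.floor_le (div_nonneg (sub_nonneg.2 hi.le) hs'.le)
    · rw [Nat.floor_of_nonpos, Nat.cast_zero]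
      exact div_nonpos_of_nonpos_of_nonneg (by linarith) hs'.le
  refine ⟨A, Finset.nonempty_iff_ne_empty.2 fun hA => ?_, hle⟩
  rw [hA, Finset.sum_empty] at hle
  have : (0 : ℝ) < k * s := by positivity
  linarith

end SlackRules

namespace Admissible

variable {k : ℕ} {δ : ℝ}

theorem exp_neg_mul_log_le (h : Admissible 1 δ) :
    Real.exp (-(1.4792 * Real.log (1 / δ))) ≤ 0.99 * δ := by
  have hL := h.le_log
  have hexp := h.exp_neg_log
  rw [Nat.cast_one] at hL hexp
  rw [div_one] at hexp
  calc _ = Real.exp (-(0.4792 * Real.log (1 / δ))) * Real.exp (-Real.log (1 / δ)) := by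
        rw [← Real.exp_add]
        ring_nf
    _ ≤ _ := by
        rw [hexp]
        gcongr
        · exact h.pos.le
        · exact exp_neg_le_of_le (by linarith)

theorem two_pow_mul_exp_le (h : Admissible k δ) (hk : 2 ≤ k) :
    2 ^ k * Real.exp (-(1.4792 * (k * Real.log (k / δ)))) ≤ 0.99 * δ := by
  have hδ := h.pos
  have hk2 : (2 : ℝ) ≤ k := by exact_mod_cast hk
  have hlogδ : k * Real.log δ ≤ 1 * Real.log δ :=
    mul_le_mul_of_nonpos_right h.one_le_k (Real.log_nonpos hδ.le h.lt_one.le)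
  have hlogk : Real.log 2 ≤ Real.log k := Real.log_le_log two_pos hk2
  have hklogk : k * Real.log 2 ≤ k * Real.log k := by gcongr
  have hlog2 : 2 * Real.log 2 ≤ k * Real.log 2 := by gcongr
  calc _ = Real.exp (k * Real.log 2 - 1.4792 * (k * Real.log (k / δ))) := by
        rw [sub_eq_add_neg, Real.exp_add, Real.exp_nat_mul, Real.exp_log two_pos]
    _ ≤ Real.exp (-0.015 + Real.log δ) := by
        refine Real.exp_le_exp.2 ?_
        rw [Real.log_div (by positivity) hδ.ne']
        linarith [Real.log_two_gt_d9, Real.log_nonpos hδ.le h.lt_one.le]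
    _ = Real.exp (-0.015) * δ := by rw [Real.exp_add, Real.exp_log hδ]
    _ ≤ 0.99 * δ := by
        gcongr
        exact exp_neg_le_of_le le_rfl

theorem two_pow_sub_one_mul_exp_le (h : Admissible k δ) :
    (2 ^ k - 1) * Real.exp (-(1.4792 * (k * Real.log (k / δ)))) ≤ 0.99 * δ := by
  obtain rfl | hk : k = 1 ∨ 2 ≤ k := by have := h.k_pos; omega
  · rw [pow_one, show (2 : ℝ) - 1 = 1 by norm_num, one_mul, Nat.cast_one, one_mul]
    exact h.exp_neg_mul_log_le
  · refine le_trans ?_ (h.two_pow_mul_exp_le hk)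
    gcongr
    exact sub_le_self _ zero_le_one

end Admissible

/-- The numbers `m` of items that a round with threshold `N` should survive: a small fraction of
the target, or, once the estimates are precise in comparison with `N`, nearly all of it. -/
def Reachable {k : ℕ} (δ : ℝ) (N₀ : ℕ) (n : Fin k → ℕ) (N m : ℕ) : Prop :=
  (m : ℝ) ≤ target δ n N / 10000 ∨
    √(N / N₀) ≤ 1 / 1000000 ∧ (m : ℝ) ≤ (1 - 216 * √(N / N₀)) * target δ n N

theorem sqrt_natCast_div_le_one {N N₀ : ℕ} (hNN₀ : N ≤ N₀) : √(N / N₀ : ℝ) ≤ 1 :=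
  Real.sqrt_le_one.2 (div_le_one_of_le₀ (by exact_mod_cast hNN₀) (Nat.cast_nonneg _))

namespace GoodSample

variable {k N₀ N m : ℕ} {δ : ℝ} {μ : Fin k → ℝ} {n : Fin k → ℕ}

theorem mul_target_le (h : GoodSample δ N₀ μ n)
    (hN : learnBeta * (k * Real.log (k / δ)) < N) (i : Fin k) :
    μ i * target δ n N ≤ muHat δ n i * target δ n N +
      8 * √(N / N₀) * √(μ i * target δ n N * Real.log (k / δ)) +
      8 * √(N / N₀) ^ 2 * Real.log (k / δ) :=
  h.mul_le_of_le (h.target_pos hN).le (h.target_le hN) i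

theorem le_target_of_reachable (h : GoodSample δ N₀ μ n)
    (hN : learnBeta * (k * Real.log (k / δ)) < N) (hm : Reachable δ N₀ n N m) :
    (m : ℝ) ≤ target δ n N := by
  have htarget := h.target_pos hN
  rcases hm with hm | ⟨-, hm⟩
  · linarith
  · refine hm.trans (mul_le_of_le_one_left htarget.le ?_)
    linarith [Real.sqrt_nonneg (N / N₀ : ℝ)]

theorem mu_le_one (h : GoodSample δ N₀ μ n) (i : Fin k) : μ i ≤ 1 := by
  rw [← h.sum_eq_one]
  exact Finset.single_le_sum (fun i _ => h.nonneg i) (Finset.mem_univ i)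

theorem binTail_upperBound_le (h : GoodSample δ N₀ μ n)
    (hN : learnBeta * (k * Real.log (k / δ)) < N) (hNN₀ : N ≤ N₀) (hm : Reachable δ N₀ n N m)
    (i : Fin k) : binTail (μ i) m (upperBound δ n N i) ≤ 0.99 * (δ / k) := by
  rw [← h.exp_neg_log]
  have htarget := (h.target_pos hN).le
  have hτ : 0 ≤ μ i * target δ n N := mul_nonneg (h.nonneg i) htarget
  have hh : 0 ≤ muHat δ n i * target δ n N := mul_nonneg (h.muHat_nonneg i) htarget
  have hs : upperBound δ n N i = muHat δ n i * target δ n N +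
      √(2 * (muHat δ n i * target δ n N) * Real.log (k / δ)) + 2 / 3 * Real.log (k / δ) := by
    unfold upperBound
    ring_nf
  rcases hm with hm | ⟨hρ, hm⟩ <;>
    have hmean := mul_le_mul_of_nonneg_left hm (h.nonneg i)
  · refine (binTail_le_of_mul_le_fraction (h.nonneg i) (h.mu_le_one i) h.log_pos.le hh
      (Real.sqrt_nonneg _) (sqrt_natCast_div_le_one hNN₀) hτ (h.mul_target_le hN i)
      (by linarith) ?_).trans (exp_neg_two_mul_le h.le_log)
    linarith [Real.sqrt_nonneg (2 * (muHat δ n i * target δ n N) * Real.log (k / δ))]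
  · exact binTail_le_of_near_target (h.nonneg i) (h.mu_le_one i) h.le_log hh
      (Real.sqrt_nonneg _) hρ hτ (h.mul_target_le hN i) (by linarith) hs.ge

theorem sum_mul_sub_le_of_le_fraction (h : GoodSample δ N₀ μ n)
    (hN : learnBeta * (k * Real.log (k / δ)) < N) (hNN₀ : N ≤ N₀)
    (hm : (m : ℝ) ≤ target δ n N / 10000) (A : Finset (Fin k)) :
    ∑ i ∈ A, (μ i * m - muHat δ n i * target δ n N) ≤ 0.0088 * (k * Real.log (k / δ)) := by
  have htarget := (h.target_pos hN).le
  have hL := h.log_pos.le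
  calc _ ≤ ∑ i ∈ A, 0.0088 * Real.log (k / δ) := by
        refine Finset.sum_le_sum fun i _ => ?_
        have := half_sub_le_of_le_add (mul_nonneg (h.nonneg i) htarget) hL (Real.sqrt_nonneg _)
          (sqrt_natCast_div_le_one hNN₀) (h.mul_target_le hN i)
        have := mul_le_mul_of_nonneg_left hm (h.nonneg i)
        have := mul_nonneg (h.muHat_nonneg i) htarget
        rcases le_total (μ i * target δ n N) (88 * Real.log (k / δ)) with _ | _ <;> linarith
    _ ≤ ∑ i : Fin k, 0.0088 * Real.log (k / δ) :=
        Finset.sum_le_sum_of_subset_of_nonneg (Finset.subset_univ _) fun _ _ _ => by positivity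
    _ = _ := by
        simp only [Finset.sum_const, Finset.card_fin, nsmul_eq_mul]
        ring

theorem sum_mul_sub_le_of_le_target (h : GoodSample δ N₀ μ n)
    (hN : learnBeta * (k * Real.log (k / δ)) < N)
    (hm : (m : ℝ) ≤ target δ n N) (A : Finset (Fin k)) :
    ∑ i ∈ A, (μ i * m - muHat δ n i * target δ n N) ≤
      8 * √(N / N₀) * (√(k * Real.log (k / δ)) * √N) +
        8 * √(N / N₀) ^ 2 * (k * Real.log (k / δ)) := by
  have htarget := (h.target_pos hN).le
  have hL := h.log_pos.le
  have hsum : ∑ i, √(μ i * target δ n N * Real.log (k / δ)) ≤ √(k * Real.log (k / δ)) * √N := by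
    refine (sum_sqrt_le_sqrt_card_mul_sum _
      fun i => mul_nonneg (mul_nonneg (h.nonneg i) htarget) hL).trans ?_
    rw [← Finset.sum_mul, ← Finset.sum_mul, h.sum_eq_one, one_mul, Finset.card_fin,
      ← Real.sqrt_mul (by positivity), mul_comm (target δ n N), mul_assoc]
    gcongr
    exact h.target_le hN
  calc _ ≤ ∑ i ∈ A, (8 * √(N / N₀) * √(μ i * target δ n N * Real.log (k / δ)) +
          8 * √(N / N₀) ^ 2 * Real.log (k / δ)) := by
        refine Finset.sum_le_sum fun i _ => ?_
        linarith [h.mul_target_le hN i, mul_le_mul_of_nonneg_left hm (h.nonneg i)]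
    _ ≤ ∑ i : Fin k, (8 * √(N / N₀) * √(μ i * target δ n N * Real.log (k / δ)) +
          8 * √(N / N₀) ^ 2 * Real.log (k / δ)) :=
        Finset.sum_le_sum_of_subset_of_nonneg (Finset.subset_univ _) fun _ _ _ => by positivity
    _ = 8 * √(N / N₀) * ∑ i, √(μ i * target δ n N * Real.log (k / δ)) +
          8 * √(N / N₀) ^ 2 * (k * Real.log (k / δ)) := by
        rw [Finset.sum_add_distrib, ← Finset.mul_sum, Finset.sum_const, Finset.card_fin,
          nsmul_eq_mul]
        ring
    _ ≤ _ := by gcongr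

theorem mul_log_le_sqrt_mul_sqrt (h : GoodSample δ N₀ μ n)
    (hN : learnBeta * (k * Real.log (k / δ)) < N) :
    9.16 * (k * Real.log (k / δ)) ≤ √(k * Real.log (k / δ)) * √N := by
  calc _ = √(k * Real.log (k / δ)) * (9.16 * √(k * Real.log (k / δ))) := by
        rw [mul_left_comm √_, Real.mul_self_sqrt h.mul_log_pos.le]
    _ ≤ _ := by
        gcongr
        exact h.sqrt_mul_log_le hN

theorem sum_mul_sub_le_of_reachable (h : GoodSample δ N₀ μ n)
    (hN : learnBeta * (k * Real.log (k / δ)) < N) (hNN₀ : N ≤ N₀) (hm : Reachable δ N₀ n N m)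
    (A : Finset (Fin k)) : ∑ i ∈ A, (μ i * m - muHat δ n i * target δ n N) ≤
      0.02 * (√(k * Real.log (k / δ)) * √N) := by
  have hKQ := h.mul_log_le_sqrt_mul_sqrt hN
  have hK := h.mul_log_pos
  rcases id hm with hfrac | ⟨hρ, -⟩
  · linarith [h.sum_mul_sub_le_of_le_fraction hN hNN₀ hfrac A]
  · refine (h.sum_mul_sub_le_of_le_target hN (h.le_target_of_reachable hN hm) A).trans ?_
    calc _ ≤ 8 * (1 / 1000000) * (√(k * Real.log (k / δ)) * √N) +
          8 * (1 / 1000000) ^ 2 * (k * Real.log (k / δ)) := by gcongr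
      _ ≤ _ := by linarith

theorem le_mul_floor_slack (h : GoodSample δ N₀ μ n)
    (hN : learnBeta * (k * Real.log (k / δ)) < N) :
    0.88 * (√(k * Real.log (k / δ)) * √N) ≤ k * (⌊(N - target δ n N) / (2 * k)⌋₊ : ℝ) := by
  have hk := h.one_le_k
  have hfloor : (N - target δ n N) / 2 ≤ k * (⌊(N - target δ n N) / (2 * k)⌋₊ + 1) := by
    calc (N - target δ n N) / 2 = k * ((N - target δ n N) / (2 * k)) := by field_simp
      _ ≤ _ := by
        gcongr
        exact (Nat.lt_floor_add_one _).le
  linarith [h.le_sub_target hN, h.mul_log_le_sqrt_mul_sqrt hN, h.le_mul_log]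

theorem floor_slack_pos (h : GoodSample δ N₀ μ n)
    (hN : learnBeta * (k * Real.log (k / δ)) < N) :
    0 < ⌊(N - target δ n N) / (2 * k)⌋₊ := by
  refine Nat.pos_of_ne_zero fun hzero => ?_
  have := h.le_mul_floor_slack hN
  rw [hzero, Nat.cast_zero, mul_zero] at this
  linarith [h.mul_log_le_sqrt_mul_sqrt hN, h.mul_log_pos]

theorem exists_le_setCount_of_learnedDynamicRule_endsAt (h : GoodSample δ N₀ μ n)
    (hN : learnBeta * (k * Real.log (k / δ)) < N) (hNN₀ : N ≤ N₀) (hm : Reachable δ N₀ n N m)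
    {a : ℕ → Fin k} {p m' : ℕ} (hm' : m' ≤ m) (hend : (learnedDynamicRule δ n N).EndsAt a p m') :
    ∃ A : Finset (Fin k), A.Nonempty ∧
      m * ∑ i ∈ A, μ i + 0.86 * (√(k * Real.log (k / δ)) * √N) ≤ setCount a p m A := by
  obtain ⟨A, hA, hslack⟩ :=
    exists_le_sum_of_dynamicRule_endsAt h.k_pos (h.floor_slack_pos hN) hend
  refine ⟨A, hA, ?_⟩
  have hcount : ∑ i ∈ A, (counter a p m' i : ℝ) ≤ setCount a p m A := by
    rw [← sum_counter_eq_setCount]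
    exact_mod_cast Finset.sum_le_sum fun i _ => counter_mono a p i hm'
  have hbase := h.sum_mul_sub_le_of_reachable hN hNN₀ hm A
  rw [Finset.sum_sub_distrib, ← Finset.sum_mul, mul_comm _ (m : ℝ)] at hbase
  rw [Finset.sum_sub_distrib] at hslack
  linarith [h.le_mul_floor_slack hN]

section Probability

variable {Ω : Type*} [MeasurableSpace Ω] {P : Measure Ω} [IsProbabilityMeasure P]
  {X : ℕ → Ω → Fin k}

theorem measureReal_learnedStaticRule_endsAt_le (h : GoodSample δ N₀ μ n)
    (hX : IsItemStream P X μ) (hN : learnBeta * (k * Real.log (k / δ)) < N) (hNN₀ : N ≤ N₀)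
    (hm : Reachable δ N₀ n N m) (p : ℕ) :
    P.real {ω | ∃ m' ≤ m, (learnedStaticRule δ n N).EndsAt (fun j => X j ω) p m'} ≤ 0.99 * δ := by
  have hk : (k : ℝ) ≠ 0 := by exact_mod_cast h.k_pos.ne'
  have hcover : {ω | ∃ m' ≤ m, (learnedStaticRule δ n N).EndsAt (fun j => X j ω) p m'} ⊆
      ⋃ i, {ω | upperBound δ n N i ≤ setCount (fun j => X j ω) p m {i}} := by
    rintro ω ⟨m', hm', hend⟩
    obtain ⟨i, hi⟩ := exists_le_counter_of_staticRule_endsAt hend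
    refine Set.mem_iUnion.2 ⟨i, hi.trans ?_⟩
    rw [setCount_singleton]
    exact_mod_cast counter_mono _ _ i hm'
  calc _ ≤ _ := measureReal_mono hcover (measure_ne_top _ _)
    _ ≤ ∑ i, P.real {ω | upperBound δ n N i ≤ setCount (fun j => X j ω) p m {i}} :=
        measureReal_iUnion_fintype_le _
    _ ≤ ∑ _i : Fin k, 0.99 * (δ / k) := by
        refine Finset.sum_le_sum fun i _ => ?_
        rw [hX.measureReal_le_setCount, Finset.sum_singleton]
        exact h.binTail_upperBound_le hN hNN₀ hm i
    _ = 0.99 * δ := by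
        rw [Finset.sum_const, Finset.card_fin, nsmul_eq_mul]
        field_simp

theorem measureReal_learnedDynamicRule_endsAt_le (h : GoodSample δ N₀ μ n)
    (hX : IsItemStream P X μ) (hN : learnBeta * (k * Real.log (k / δ)) < N) (hNN₀ : N ≤ N₀)
    (hm : Reachable δ N₀ n N m) (p : ℕ) :
    P.real {ω | ∃ m' ≤ m, (learnedDynamicRule δ n N).EndsAt (fun j => X j ω) p m'} ≤ 0.99 * δ := by
  have hK := h.mul_log_pos
  have hN0 : (0 : ℝ) < N := by linarith [h.mul_log_lt hN]
  have hmN : m ≤ N := by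
    exact_mod_cast (h.le_target_of_reachable hN hm).trans (h.target_le hN)
  let y := 0.86 * (√(k * Real.log (k / δ)) * √N)
  have hy : 2 * y ^ 2 / N = 1.4792 * (k * Real.log (k / δ)) := by
    rw [mul_pow, mul_pow, Real.sq_sqrt hK.le, Real.sq_sqrt hN0.le]
    field_simp
    ring
  have hcover : {ω | ∃ m' ≤ m, (learnedDynamicRule δ n N).EndsAt (fun j => X j ω) p m'} ⊆
      ⋃ A ∈ Finset.univ.erase ∅,
        {ω | m * ∑ i ∈ A, μ i + y ≤ setCount (fun j => X j ω) p m A} := by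
    rintro ω ⟨m', hm', hend⟩
    obtain ⟨A, hA, hcount⟩ :=
      h.exists_le_setCount_of_learnedDynamicRule_endsAt hN hNN₀ hm hm' hend
    exact Set.mem_biUnion (Finset.mem_erase.2 ⟨hA.ne_empty, Finset.mem_univ A⟩) hcount
  calc _ ≤ _ := measureReal_mono hcover (measure_ne_top _ _)
    _ ≤ ∑ A ∈ Finset.univ.erase ∅,
        P.real {ω | m * ∑ i ∈ A, μ i + y ≤ setCount (fun j => X j ω) p m A} :=
        measureReal_biUnion_finset_le _ _
    _ ≤ ∑ _A ∈ (Finset.univ : Finset (Finset (Fin k))).erase ∅,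
        Real.exp (-(1.4792 * (k * Real.log (k / δ)))) := by
        refine Finset.sum_le_sum fun A _ => ?_
        rw [← hy]
        exact hX.measureReal_le_setCount_hoeffding_of_le A p hmN (by positivity)
    _ = (2 ^ k - 1) * Real.exp (-(1.4792 * (k * Real.log (k / δ)))) := by
        rw [Finset.sum_const, Finset.card_erase_of_mem (Finset.mem_univ _), Finset.card_univ,
          Fintype.card_finset, Fintype.card_fin, nsmul_eq_mul, Nat.cast_sub Nat.one_le_two_pow]
        norm_num
    _ ≤ _ := h.two_pow_sub_one_mul_exp_le

end Probability

end GoodSample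

/-! ### The learning round -/

theorem exp_neg_le_quadratic {θ : ℝ} (hθ : 0 ≤ θ) : Real.exp (-θ) ≤ 1 - θ + θ ^ 2 / 2 := by
  rw [Real.exp_neg, inv_le_iff_one_le_mul₀ (Real.exp_pos θ)]
  have : 0 ≤ 1 - θ + θ ^ 2 / 2 := by nlinarith [sq_nonneg (θ - 1)]
  calc (1 : ℝ) ≤ (1 - θ + θ ^ 2 / 2) * (1 + θ + θ ^ 2 / 2) := by
        nlinarith [sq_nonneg (θ ^ 2)]
    _ ≤ _ := by
        gcongr
        exact Real.quadratic_le_exp_of_nonneg hθ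

theorem mul_exp_neg_add_one_sub_le {q θ : ℝ} (hq : 0 ≤ q) (hθ : 0 ≤ θ) :
    q * Real.exp (-θ) + (1 - q) ≤ Real.exp (-(q * (θ - θ ^ 2 / 2))) := by
  have := mul_le_mul_of_nonneg_left (exp_neg_le_quadratic hθ) hq
  linarith [Real.add_one_le_exp (-(q * (θ - θ ^ 2 / 2)))]

theorem exists_slope_of_undercount {q M L : ℝ} (hq : 0 ≤ q) (hL : 0 < L) :
    ∃ θ : ℝ, 0 ≤ θ ∧ ∀ c m : ℝ, m ≤ M → c + 3 * √(q * M * L) + 3 * L < q * m →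
      θ * c + 2 * L ≤ q * (θ - θ ^ 2 / 2) * m := by
  rcases le_or_gt (q * M) 0 with hqM | hqM
  · refine ⟨1, zero_le_one, fun c m hm hlt => ?_⟩
    have : q * m ≤ q * M := by gcongr
    linarith [Real.sqrt_nonneg (q * M * L)]
  · have hroot : √(q * M * L) ^ 2 = q * M * L := Real.sq_sqrt (by positivity)
    have hpos : 0 < √(q * M * L) := by positivity
    obtain ⟨θ, hθ, hlin, hquad⟩ :
        ∃ θ, 0 ≤ θ ∧ θ * √(q * M * L) = L ∧ q * M * θ ^ 2 = L := by
      refine ⟨L / √(q * M * L), by positivity, div_mul_cancel₀ _ hpos.ne', ?_⟩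
      rw [div_pow, hroot, mul_div_assoc', div_eq_iff (by positivity)]
      ring
    refine ⟨θ, hθ, fun c m hm hlt => ?_⟩
    have hm' : q * m * θ ^ 2 ≤ q * M * θ ^ 2 := by gcongr
    linear_combination
      θ * hlt.le - 3 * hlin + (hm' + hquad) / 2 + hL.le / 2 + 3 * mul_nonneg hθ hL.le

/-- At some moment among the first `N₀` items of the stream, player `i` has received far fewer items
than expected. -/
def Undercounted {k : ℕ} (L : ℝ) (N₀ : ℕ) (μ : Fin k → ℝ) (a : ℕ → Fin k) (i : Fin k) : Prop :=
  ∃ m ≤ N₀, counter a 0 m i + 3 * √(μ i * N₀ * L) + 3 * L < μ i * m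

theorem Admissible.mul_exp_le {k : ℕ} {δ : ℝ} (h : Admissible k δ) :
    k * Real.exp (-(2 * Real.log (k / δ))) ≤ δ / 2 := by
  have hk := h.one_le_k
  have hδ := h.pos
  have hhalf : δ / k ≤ 1 / 2 := by
    rw [← inv_div, one_div]
    exact inv_anti₀ two_pos h.two_le_div
  calc _ = (k : ℝ) * (δ / k * (δ / k)) := by
        rw [two_mul, neg_add, Real.exp_add, h.exp_neg_log]
    _ = δ * (δ / k) := by field_simp
    _ ≤ δ * (1 / 2) := by gcongr
    _ = _ := by ring

section Undercount

variable {k : ℕ} {μ : Fin k → ℝ} {Ω : Type*} [MeasurableSpace Ω] {P : Measure Ω}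
  [IsProbabilityMeasure P] {X : ℕ → Ω → Fin k}

theorem IsItemStream.measureReal_undercounted_le (hX : IsItemStream P X μ) {L : ℝ} (hL : 0 < L)
    (N₀ : ℕ) (i : Fin k) :
    P.real {ω | Undercounted L N₀ μ (fun j => X j ω) i} ≤ Real.exp (-(2 * L)) := by
  obtain ⟨θ, hθ, hline⟩ := exists_slope_of_undercount (M := N₀) (hX.nonneg i) hL
  refine (measureReal_mono ?_ (measure_ne_top _ _)).trans
    (hX.measureReal_exists_setCount_le_line {i} (θ := θ) (c := μ i * (θ - θ ^ 2 / 2)) ?_ 0 N₀ _)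
  · rintro ω ⟨m, hm, hlt⟩
    refine ⟨m, hm, ?_⟩
    rw [setCount_singleton]
    exact hline _ _ (by exact_mod_cast hm) hlt
  · rw [Finset.sum_singleton]
    exact mul_exp_neg_add_one_sub_le (hX.nonneg i) hθ

theorem IsItemStream.measureReal_exists_undercounted_le (hX : IsItemStream P X μ) {δ : ℝ}
    (h : Admissible k δ) (N₀ : ℕ) :
    P.real {ω | ∃ i, Undercounted (Real.log (k / δ)) N₀ μ (fun j => X j ω) i} ≤ δ / 2 := by
  rw [Set.ofPred_exists]
  calc _ ≤ ∑ i, P.real {ω | Undercounted (Real.log (k / δ)) N₀ μ (fun j => X j ω) i} :=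
        measureReal_iUnion_fintype_le _
    _ ≤ ∑ _i : Fin k, Real.exp (-(2 * Real.log (k / δ))) :=
        Finset.sum_le_sum fun i _ => hX.measureReal_undercounted_le h.log_pos N₀ i
    _ = k * Real.exp (-(2 * Real.log (k / δ))) := by
        rw [Finset.sum_const, Finset.card_fin, nsmul_eq_mul]
    _ ≤ _ := h.mul_exp_le

end Undercount

theorem total_counter {k : ℕ} (a : ℕ → Fin k) (p m : ℕ) : total (counter a p m) = m := by
  unfold total
  exact_mod_cast sum_counter a p m

theorem goodSample_of_not_undercounted {k N₀ w : ℕ} {δ : ℝ} {μ : Fin k → ℝ} {a : ℕ → Fin k}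
    (h : Admissible k δ) (hN₀ : learnBeta * (k * Real.log (k / δ)) < N₀) (hμ : ∀ i, 0 ≤ μ i)
    (hsum : ∑ i, μ i = 1) (hw : (cmyRule k N₀).EndsAt a 0 w)
    (hcount : ¬ ∃ i, Undercounted (Real.log (k / δ)) N₀ μ a i) :
    GoodSample δ N₀ μ (counter a 0 w) where
  toAdmissible := h
  large := hN₀
  nonneg := hμ
  sum_eq_one := hsum
  two_fifths_le_total := by
    have hw' : (k * (N₀ / (2 * k) : ℕ) : ℝ) ≤ w := by exact_mod_cast le_of_cmyRule_endsAt hw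
    have hdiv : (N₀ : ℝ) < 2 * k * ((N₀ / (2 * k) : ℕ) + 1) := by
      exact_mod_cast Nat.lt_mul_div_succ N₀ (by have := h.k_pos; omega : 0 < 2 * k)
    rw [total_counter]
    linarith [h.mul_log_lt hN₀, h.le_mul_log]
  mul_total_le i := by
    rw [total_counter]
    have hlarge : 2 * k ≤ N₀ := by
      have : (2 * k : ℝ) ≤ N₀ := by linarith [h.mul_log_lt hN₀, h.le_mul_log, h.one_le_k]
      exact_mod_cast this
    exact not_lt.1 fun hlt => hcount ⟨i, w, cmyRule_endsAt_le h.k_pos hlarge hw, hlt⟩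

/-! ### The potential -/

theorem one_le_loglog (x : ℝ) : 1 ≤ loglog x := by
  rw [loglog, Real.le_log_iff_exp_le (lt_max_of_lt_left (Real.exp_pos 1))]
  exact le_max_left _ _

/-- The potential of a round whose threshold is `x` times the scale `k log (k / δ)`, where the
initial threshold is `x₀` times the scale. It decreases by `1` when `log x` shrinks, or
`1 + log (x₀ / x)` grows, by the factor `1 ± 10⁻⁷`. -/
noncomputable def potential (x₀ x : ℝ) : ℝ :=
  20000000 * (Real.log (Real.log x) + Real.log (1 + Real.log x₀) -
    Real.log (1 + Real.log (x₀ / x)))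

section Potential

variable {x₀ x x' : ℝ}

theorem one_le_log_of_ge (hx : 84 ≤ x) : 1 ≤ Real.log x := by
  rw [Real.le_log_iff_exp_le (by linarith)]
  linarith [Real.exp_one_lt_d9]

theorem log_log_mono (hx' : 84 ≤ x') (hxx : x' ≤ x) :
    Real.log (Real.log x') ≤ Real.log (Real.log x) :=
  Real.log_le_log (by linarith [one_le_log_of_ge hx']) (Real.log_le_log (by linarith) hxx)

theorem log_div_nonneg (hx : 0 < x) (hle : x ≤ x₀) : 0 ≤ Real.log (x₀ / x) :=
  Real.log_nonneg ((one_le_div₀ hx).2 hle)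

theorem log_one_add_log_div_anti (hx' : 0 < x') (hxx : x' ≤ x) (hle : x ≤ x₀) :
    Real.log (1 + Real.log (x₀ / x)) ≤ Real.log (1 + Real.log (x₀ / x')) := by
  have hx : 0 < x := hx'.trans_le hxx
  have hx₀ : 0 < x₀ := hx.trans_le hle
  have := log_div_nonneg hx hle
  gcongr

theorem potential_mono (hx' : 84 ≤ x') (hxx : x' ≤ x) (hle : x ≤ x₀) :
    potential x₀ x' ≤ potential x₀ x := by
  unfold potential
  linarith [log_log_mono hx' hxx, log_one_add_log_div_anti (by linarith) hxx hle]

theorem potential_nonneg (hx : 84 ≤ x) (hle : x ≤ x₀) : 0 ≤ potential x₀ x := by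
  have hloglog := Real.log_nonneg (one_le_log_of_ge hx)
  have hratio := log_one_add_log_div_anti one_pos (by linarith : 1 ≤ x) hle
  rw [div_one] at hratio
  unfold potential
  linarith

theorem potential_self_le (hx : 84 ≤ x₀) : potential x₀ x₀ ≤ 60000000 * loglog x₀ := by
  have hlog := one_le_log_of_ge hx
  have hloglog : Real.log (Real.log x₀) ≤ loglog x₀ :=
    Real.log_le_log (by linarith) (le_max_right _ _)
  have hadd : Real.log (1 + Real.log x₀) ≤ 1 + loglog x₀ := by
    calc Real.log (1 + Real.log x₀) ≤ Real.log (2 * Real.log x₀) :=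
          Real.log_le_log (by linarith) (by linarith)
      _ = Real.log 2 + Real.log (Real.log x₀) := Real.log_mul two_ne_zero (by linarith)
      _ ≤ _ := by linarith [Real.log_two_lt_d9]
  unfold potential
  rw [div_self (by linarith), Real.log_one, add_zero, Real.log_one]
  linarith [one_le_loglog x₀]

theorem potential_le_sub_one_of_log (hx' : 84 ≤ x') (hxx : x' ≤ x) (hle : x ≤ x₀)
    (h : Real.log x' ≤ (1 - 1 / 10000000) * Real.log x) :
    potential x₀ x' ≤ potential x₀ x - 1 := by
  have hlog := one_le_log_of_ge (hx'.trans hxx)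
  have hdrop : Real.log (Real.log x') ≤ Real.log (Real.log x) - 1 / 10000000 := by
    calc Real.log (Real.log x') ≤ Real.log ((1 - 1 / 10000000) * Real.log x) :=
          Real.log_le_log (by linarith [one_le_log_of_ge hx']) h
      _ = Real.log (1 - 1 / 10000000) + Real.log (Real.log x) :=
          Real.log_mul (by norm_num) (by linarith)
      _ ≤ _ := by
          linarith [Real.log_le_sub_one_of_pos (show (0 : ℝ) < 1 - 1 / 10000000 by norm_num)]
  unfold potential
  linarith [log_one_add_log_div_anti (by linarith) hxx hle]

theorem potential_le_sub_one_of_ratio (hx' : 84 ≤ x') (hxx : x' ≤ x) (hle : x ≤ x₀)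
    (h : (1 + 1 / 10000000) * (1 + Real.log (x₀ / x)) ≤ 1 + Real.log (x₀ / x')) :
    potential x₀ x' ≤ potential x₀ x - 1 := by
  have hratio := log_div_nonneg (by linarith) hle
  have hgain : Real.log (1 + Real.log (x₀ / x)) + 1 / 20000000 ≤
      Real.log (1 + Real.log (x₀ / x')) := by
    have hfactor : (1 / 20000000 : ℝ) ≤ Real.log (1 + 1 / 10000000) :=
      le_trans (by norm_num) (Real.one_sub_inv_le_log_of_pos (by norm_num))
    calc _ ≤ Real.log (1 + 1 / 10000000) + Real.log (1 + Real.log (x₀ / x)) := by linarith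
      _ = Real.log ((1 + 1 / 10000000) * (1 + Real.log (x₀ / x))) :=
          (Real.log_mul (by norm_num) (by linarith)).symm
      _ ≤ _ := Real.log_le_log (by positivity) h
  unfold potential
  linarith [log_log_mono hx' hxx]

theorem log_le_log_add_log {c : ℝ} (hx' : 0 < x') (hx : 0 < x) (hc : 0 < c) (h : x' ≤ c * x) :
    Real.log x' ≤ Real.log c + Real.log x := by
  rw [← Real.log_mul hc.ne' hx.ne']
  exact Real.log_le_log hx' h

theorem log_div_le_log_div_sub {c : ℝ} (hx' : 0 < x') (hx : 0 < x) (hx₀ : 0 < x₀) (hc : 0 < c)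
    (h : x' ≤ c * x) : Real.log (x₀ / x) - Real.log c ≤ Real.log (x₀ / x') := by
  rw [Real.log_div hx₀.ne' hx.ne', Real.log_div hx₀.ne' hx'.ne']
  linarith [log_le_log_add_log hx' hx hc h]

theorem log_pow_le_mul_sub_one {y : ℝ} (hy : 0 < y) (n : ℕ) : Real.log (y ^ n) ≤ n * (y - 1) := by
  rw [Real.log_pow]
  gcongr
  exact Real.log_le_sub_one_of_pos hy

theorem potential_le_sub_one_of_fraction_of_le (hx' : 84 ≤ x') (hle : x ≤ x₀)
    (h : x' ≤ (1 - 1 / 30000) * x) (hx : x ≤ 22 ^ 4) : potential x₀ x' ≤ potential x₀ x - 1 := by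
  refine potential_le_sub_one_of_log hx' (by linarith) hle ?_
  have hdrop : Real.log x' ≤ Real.log (1 - 1 / 30000) + Real.log x :=
    log_le_log_add_log (by linarith) (by linarith) (by norm_num) h
  have hfactor := Real.log_le_sub_one_of_pos (show (0 : ℝ) < 1 - 1 / 30000 by norm_num)
  have hlog : Real.log x ≤ (4 : ℕ) * (22 - 1) :=
    (Real.log_le_log (by linarith) hx).trans (log_pow_le_mul_sub_one (by norm_num) 4)
  norm_num at hlog
  linarith

theorem potential_le_sub_one_of_fraction_of_ge (hx' : 84 ≤ x') (hle : x ≤ x₀)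
    (h : x' ≤ (1 - 1 / 30000) * x) (hx : x₀ ≤ 10 ^ 12 * x) :
    potential x₀ x' ≤ potential x₀ x - 1 := by
  have hx0 : 0 < x := by linarith
  refine potential_le_sub_one_of_ratio hx' (by linarith) hle ?_
  have hgain : Real.log (x₀ / x) - Real.log (1 - 1 / 30000) ≤ Real.log (x₀ / x') :=
    log_div_le_log_div_sub (by linarith) hx0 (by linarith) (by norm_num) h
  have hfactor := Real.log_le_sub_one_of_pos (show (0 : ℝ) < 1 - 1 / 30000 by norm_num)
  have hlog : Real.log (x₀ / x) ≤ (12 : ℕ) * (10 - 1) :=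
    (Real.log_le_log (div_pos (by linarith) hx0) ((div_le_iff₀ hx0).2 hx)).trans
      (log_pow_le_mul_sub_one (by norm_num) 12)
  norm_num at hlog
  linarith

theorem potential_le_sub_one_of_sqrt (hx' : 84 ≤ x') (hx : 22 ^ 4 ≤ x) (hle : x ≤ x₀)
    (h : x' ≤ 20 * √x) : potential x₀ x' ≤ potential x₀ x - 1 := by
  have hx0 : 0 < x := by linarith
  have hdrop := log_le_log_add_log (by linarith) (Real.sqrt_pos.2 hx0) (by norm_num) h
  rw [Real.log_sqrt hx0.le] at hdrop
  have hfactor : 4 * Real.log 20 ≤ Real.log x := by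
    calc 4 * Real.log 20 = Real.log (20 ^ 4) := by rw [Real.log_pow]; norm_num
      _ ≤ _ := Real.log_le_log (by norm_num) (by linarith)
  have hlog := one_le_log_of_ge (x := x) (by linarith)
  have hxx : x' ≤ x := by
    rw [← Real.log_le_log_iff (by linarith) hx0]
    linarith
  exact potential_le_sub_one_of_log hx' hxx hle (by linarith)

theorem potential_le_sub_one_of_sqrt_ratio (hx' : 84 ≤ x') (hx : 0 < x) (hle : 10 ^ 12 * x ≤ x₀)
    (h : x' ≤ 432 * √(x / x₀) * x) : potential x₀ x' ≤ potential x₀ x - 1 := by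
  have hx₀ : 0 < x₀ := by linarith
  have hratio : 0 < x / x₀ := by positivity
  have hgain := log_div_le_log_div_sub (by linarith) hx hx₀ (by positivity) h
  rw [Real.log_mul (by norm_num) (Real.sqrt_pos.2 hratio).ne', Real.log_sqrt hratio.le,
    ← inv_div x₀, Real.log_inv] at hgain
  have hle' : 10 ^ 12 ≤ x₀ / x := (le_div_iff₀ hx).2 hle
  have hfactor : 4 * Real.log 432 ≤ Real.log (x₀ / x) := by
    calc 4 * Real.log 432 = Real.log (432 ^ 4) := by rw [Real.log_pow]; norm_num
      _ ≤ _ := Real.log_le_log (by norm_num) (by linarith)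
  have hlog := one_le_log_of_ge (x := x₀ / x) (by linarith)
  have hxx : x' ≤ x := by
    have : Real.log (x₀ / x) ≤ Real.log (x₀ / x') := by linarith
    rwa [Real.log_le_log_iff (by positivity) (by positivity),
      div_le_div_iff_of_pos_left hx₀ hx (by linarith)] at this
  exact potential_le_sub_one_of_ratio hx' hxx (by linarith) (by linarith)

theorem potential_le_sub_one_of_near_target (hx' : 84 ≤ x') (hx : 22 ^ 4 ≤ x)
    (hle : 10 ^ 12 * x ≤ x₀) (h : x' ≤ 10 * √x + 216 * √(x / x₀) * x) :
    potential x₀ x' ≤ potential x₀ x - 1 := by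
  rcases le_total (216 * √(x / x₀) * x) (10 * √x) with hcmp | hcmp
  · exact potential_le_sub_one_of_sqrt hx' hx (by linarith) (by linarith)
  · exact potential_le_sub_one_of_sqrt_ratio hx' (by linarith) hle (by linarith)

end Potential

/-! ### The number of rounds -/

theorem natCast_sub_of_lt {T : ℝ} (hT : 0 ≤ T) {N t : ℕ} (h : T < (N - t : ℕ)) :
    ((N - t : ℕ) : ℝ) = N - t := by
  have hpos : 0 < N - t := by exact_mod_cast hT.trans_lt h
  exact Nat.cast_sub (by omega)

/-- The potential of a round with threshold `N` in a run that starts with the threshold `N₀`. -/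
noncomputable def roundPotential (k : ℕ) (δ : ℝ) (N₀ N : ℕ) : ℝ :=
  potential (N₀ / (k * Real.log (k / δ))) (N / (k * Real.log (k / δ)))

namespace Admissible

variable {k N₀ N t : ℕ} {δ : ℝ}

theorem switch_nonneg (h : Admissible k δ) : 0 ≤ learnBeta * (k * Real.log (k / δ)) :=
  mul_nonneg (by linarith [le_learnBeta]) h.mul_log_pos.le

theorem le_div_mul_log (h : Admissible k δ) (hN : learnBeta * (k * Real.log (k / δ)) < N) :
    84 ≤ (N : ℝ) / (k * Real.log (k / δ)) :=
  (le_div_iff₀ h.mul_log_pos).2 (h.mul_log_lt hN).le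

theorem div_mul_log_le_div_mul_log (h : Admissible k δ) (hNN₀ : N ≤ N₀) :
    (N : ℝ) / (k * Real.log (k / δ)) ≤ N₀ / (k * Real.log (k / δ)) := by
  have := h.mul_log_pos
  gcongr

theorem roundPotential_nonneg (h : Admissible k δ)
    (hN : learnBeta * (k * Real.log (k / δ)) < N) (hNN₀ : N ≤ N₀) :
    0 ≤ roundPotential k δ N₀ N :=
  potential_nonneg (h.le_div_mul_log hN) (h.div_mul_log_le_div_mul_log hNN₀)

theorem roundPotential_mono (h : Admissible k δ) {N' : ℕ}
    (hN' : learnBeta * (k * Real.log (k / δ)) < N') (hNN : N' ≤ N) (hNN₀ : N ≤ N₀) :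
    roundPotential k δ N₀ N' ≤ roundPotential k δ N₀ N :=
  potential_mono (h.le_div_mul_log hN') (h.div_mul_log_le_div_mul_log hNN)
    (h.div_mul_log_le_div_mul_log hNN₀)

theorem roundPotential_sub_le_of_fraction (h : Admissible k δ) (hNN₀ : N ≤ N₀)
    (hN : learnBeta * (k * Real.log (k / δ)) < (N - t : ℕ)) (ht : (N : ℝ) / 30000 ≤ t)
    (hend : (N : ℝ) / (k * Real.log (k / δ)) ≤ 22 ^ 4 ∨
      (N₀ : ℝ) / (k * Real.log (k / δ)) ≤ 10 ^ 12 * (N / (k * Real.log (k / δ)))) :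
    roundPotential k δ N₀ (N - t) ≤ roundPotential k δ N₀ N - 1 := by
  have hK := h.mul_log_pos
  have hlarge := h.le_div_mul_log hN
  have hle := h.div_mul_log_le_div_mul_log hNN₀
  have hshrink : ((N - t : ℕ) : ℝ) / (k * Real.log (k / δ)) ≤
      (1 - 1 / 30000) * (N / (k * Real.log (k / δ))) := by
    rw [natCast_sub_of_lt h.switch_nonneg hN, ← mul_div_assoc]
    gcongr
    linarith
  rcases hend with hend | hend
  · exact potential_le_sub_one_of_fraction_of_le hlarge hle hshrink hend
  · exact potential_le_sub_one_of_fraction_of_ge hlarge hle hshrink hend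

theorem roundPotential_sub_le_of_near_target (h : Admissible k δ)
    (hN : learnBeta * (k * Real.log (k / δ)) < (N - t : ℕ))
    (ht : (N : ℝ) - t ≤ 10 * (√(k * Real.log (k / δ)) * √N) + 216 * √(N / N₀) * N)
    (hlow : 22 ^ 4 ≤ (N : ℝ) / (k * Real.log (k / δ)))
    (hhigh : 10 ^ 12 * (N / (k * Real.log (k / δ))) ≤ (N₀ : ℝ) / (k * Real.log (k / δ))) :
    roundPotential k δ N₀ (N - t) ≤ roundPotential k δ N₀ N - 1 := by
  have hK := h.mul_log_pos
  refine potential_le_sub_one_of_near_target (h.le_div_mul_log hN) hlow hhigh ?_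
  rw [natCast_sub_of_lt h.switch_nonneg hN, div_div_div_cancel_right₀ hK.ne',
    Real.sqrt_div (Nat.cast_nonneg N), div_le_iff₀ hK]
  have hroot := Real.mul_self_sqrt hK.le
  calc (N : ℝ) - t ≤ 10 * (√(k * Real.log (k / δ)) * √N) + 216 * √(N / N₀) * N := ht
    _ = 10 * (√N / √(k * Real.log (k / δ))) *
          (√(k * Real.log (k / δ)) * √(k * Real.log (k / δ))) +
        216 * √(N / N₀) * (N / (k * Real.log (k / δ))) * (k * Real.log (k / δ)) := by
      have := Real.sqrt_pos.2 hK
      rw [mul_assoc (216 * _), div_mul_cancel₀ _ hK.ne']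
      field_simp
    _ = _ := by rw [hroot, add_mul]

theorem pow_mul_exp_le (h : Admissible k δ) {Φ : ℝ} (hΦ : 0 ≤ Φ) {r : ℕ}
    (hr : 1200 * Φ + 400 ≤ r) :
    (0.99 * δ + δ / 200) ^ r * Real.exp (Real.log (200 / δ) * Φ) ≤ δ / 2 := by
  have hδ := h.pos
  have hfactor : Real.log 0.995 ≤ -0.005 :=
    (Real.log_le_sub_one_of_pos (by norm_num)).trans (by norm_num)
  have hlog200 : Real.log 200 ≤ 6 := by
    calc Real.log 200 ≤ Real.log (2 ^ 8) := Real.log_le_log (by norm_num) (by norm_num)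
      _ = (8 : ℕ) * Real.log 2 := Real.log_pow 2 8
      _ ≤ 6 := by norm_num; linarith [Real.log_two_lt_d9]
  have hpow : (0.99 * δ + δ / 200) ^ r = Real.exp (r * (Real.log 0.995 + Real.log δ)) := by
    rw [Real.exp_nat_mul, ← Real.log_mul (by norm_num) hδ.ne', Real.exp_log (by positivity)]
    ring
  have hhalf : δ / 2 = Real.exp (Real.log δ - Real.log 2) := by
    rw [Real.exp_sub, Real.exp_log hδ, Real.exp_log two_pos]
  rw [hpow, hhalf, ← Real.exp_add, Real.log_div (by norm_num) hδ.ne', Real.exp_le_exp]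
  have hdecay : (r : ℝ) * Real.log 0.995 ≤ r * (-0.005) := by gcongr
  have hdelta : (r : ℝ) * Real.log δ ≤ (Φ + 1) * Real.log δ :=
    mul_le_mul_of_nonpos_right (by linarith) (Real.log_nonpos hδ.le h.lt_one.le)
  have hweight : Real.log 200 * Φ ≤ 6 * Φ := by gcongr
  linarith [Real.log_two_lt_d9]

end Admissible

/-- What the analysis asks of the rounds played after the learning round has produced the counters
`n`; the field `measureReal_endsAt_le` is the only probabilistic property of the two slack rules
that it uses. -/
structure ReliableRounds {k : ℕ} {Ω : Type*} [MeasurableSpace Ω] (P : Measure Ω)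
    (X : ℕ → Ω → Fin k) (δ : ℝ) (N₀ : ℕ) (n : Fin k → ℕ) (rule : ℕ → RoundRule k) : Prop where
  cost_le (N : ℕ) : (rule N).cost ≤ 4 * k
  exists_endsAt (N : ℕ) : learnBeta * (k * Real.log (k / δ)) < N →
    ∀ a p, ∃ m, (rule N).EndsAt a p m
  measureReal_endsAt_le (N m : ℕ) : learnBeta * (k * Real.log (k / δ)) < N → N ≤ N₀ →
    Reachable δ N₀ n N m → ∀ p,
      P.real {ω | ∃ m' ≤ m, (rule N).EndsAt (fun j => X j ω) p m'} ≤ 0.99 * δ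

/-- A number of rounds that suffices, up to a failure probability of `δ / 2`, to bring the threshold
from `N₀` down to the switching point. -/
noncomputable def roundBound (k : ℕ) (δ : ℝ) (N₀ : ℕ) : ℕ :=
  ⌈1200 * roundPotential k δ N₀ N₀ + 400⌉₊

theorem Admissible.roundBound_le {k N₀ : ℕ} {δ : ℝ} (h : Admissible k δ)
    (hN₀ : learnBeta * (k * Real.log (k / δ)) < N₀) :
    (roundBound k δ N₀ : ℝ) ≤ 73000000000 * loglog (N₀ / (k * Real.log (k / δ))) := by
  have hpotential : roundPotential k δ N₀ N₀ ≤ _ := potential_self_le (h.le_div_mul_log hN₀)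
  have hceil := Nat.ceil_lt_add_one
    (by linarith [h.roundPotential_nonneg hN₀ le_rfl] :
      0 ≤ 1200 * roundPotential k δ N₀ N₀ + 400)
  unfold roundBound
  linarith [one_le_loglog (N₀ / (k * Real.log (k / δ)))]

namespace GoodSample

variable {k N₀ N : ℕ} {δ : ℝ} {μ : Fin k → ℝ} {n : Fin k → ℕ}

theorem exists_reachable_fraction (h : GoodSample δ N₀ μ n)
    (hN : learnBeta * (k * Real.log (k / δ)) < N) :
    ∃ m : ℕ, Reachable δ N₀ n N m ∧ N / 30000 ≤ (m : ℝ) + 1 := by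
  refine ⟨⌊target δ n N / 10000⌋₊,
    .inl (Nat.floor_le (div_nonneg (h.target_pos hN).le (by norm_num))), ?_⟩
  linarith [Nat.lt_floor_add_one (target δ n N / 10000), h.third_le_target hN]

theorem exists_reachable_near_target (h : GoodSample δ N₀ μ n)
    (hN : learnBeta * (k * Real.log (k / δ)) < N) (hNN₀ : N ≤ N₀)
    (hρ : √(N / N₀ : ℝ) ≤ 1 / 1000000) :
    ∃ m : ℕ, Reachable δ N₀ n N m ∧
      N - ((m : ℝ) + 1) ≤ 10 * (√(k * Real.log (k / δ)) * √N) + 216 * √(N / N₀) * N := by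
  refine ⟨⌊(1 - 216 * √(N / N₀)) * target δ n N⌋₊, .inr ⟨hρ, Nat.floor_le
    (mul_nonneg (by linarith) (h.target_pos hN).le)⟩, ?_⟩
  have hloss : √(N / N₀ : ℝ) * target δ n N ≤ √(N / N₀) * N := by
    gcongr
    exact h.target_le hN
  have : 0 ≤ √(k * Real.log (k / δ)) * √N := by positivity
  linarith [Nat.lt_floor_add_one ((1 - 216 * √(N / N₀)) * target δ n N), h.sub_target_le hNN₀]

theorem exists_reachable_roundPotential_le (h : GoodSample δ N₀ μ n)
    (hN : learnBeta * (k * Real.log (k / δ)) < N) (hNN₀ : N ≤ N₀) :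
    ∃ m : ℕ, Reachable δ N₀ n N m ∧
      (learnBeta * (k * Real.log (k / δ)) < (N - (m + 1) : ℕ) →
        roundPotential k δ N₀ (N - (m + 1)) ≤ roundPotential k δ N₀ N - 1) := by
  by_cases hend : (N : ℝ) / (k * Real.log (k / δ)) ≤ 22 ^ 4 ∨
      (N₀ : ℝ) / (k * Real.log (k / δ)) ≤ 10 ^ 12 * (N / (k * Real.log (k / δ)))
  · obtain ⟨m, hm, hge⟩ := h.exists_reachable_fraction hN
    exact ⟨m, hm, fun hT =>
      h.roundPotential_sub_le_of_fraction hNN₀ hT (by push_cast; exact hge) hend⟩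
  · push Not at hend
    have hρ : √(N / N₀ : ℝ) ≤ 1 / 1000000 := by
      have hhigh := hend.2
      rw [← mul_div_assoc, div_lt_div_iff_of_pos_right h.mul_log_pos] at hhigh
      refine Real.sqrt_le_iff.2 ⟨by norm_num, (div_le_iff₀ h.N₀_pos).2 ?_⟩
      linarith
    obtain ⟨m, hm, hle⟩ := h.exists_reachable_near_target hN hNN₀ hρ
    exact ⟨m, hm, fun hT => h.roundPotential_sub_le_of_near_target hT (by push_cast; exact hle)
      hend.1.le hend.2.le⟩

theorem measureReal_unfinished_le {Ω : Type*} [MeasurableSpace Ω] {P : Measure Ω}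
    [IsProbabilityMeasure P] {X : ℕ → Ω → Fin k} (h : GoodSample δ N₀ μ n)
    (hX : IsItemStream P X μ) {rule : ℕ → RoundRule k}
    (hrule : ReliableRounds P X δ N₀ n rule) (p : ℕ) (hNN₀ : N ≤ N₀) :
    P.real {ω | Unfinished (learnBeta * (k * Real.log (k / δ))) rule (fun j => X j ω)
      (roundBound k δ N₀) p N} ≤ δ / 2 := by
  have hδ := h.pos
  have hweight : 0 ≤ Real.log (200 / δ) :=
    Real.log_nonneg ((one_le_div₀ hδ).2 (by linarith [h.lt_one]))
  by_cases hN : learnBeta * (k * Real.log (k / δ)) < N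
  swap
  · rw [measureReal_unfinished_eq_zero hN]
    positivity
  have hbound := hX.measureReal_unfinished_le (N₀ := N₀) (f := 0.99 * δ) (κ := δ / 200)
    (W := fun N => Real.exp (Real.log (200 / δ) * roundPotential k δ N₀ N))
    (rule := rule) (by positivity) (by positivity)
    (fun N hN hle => Real.one_le_exp (mul_nonneg hweight (h.roundPotential_nonneg hN hle)))
    (fun N N' hN' hNN hle => Real.exp_le_exp.2
      (mul_le_mul_of_nonneg_left (h.roundPotential_mono hN' hNN hle) hweight))
    (fun N hN hle => ?_) (roundBound k δ N₀) p N hN hNN₀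
  · refine (hbound.trans (mul_le_mul_of_nonneg_left ?_ (by positivity))).trans
      (h.pow_mul_exp_le (h.roundPotential_nonneg h.large le_rfl) (Nat.le_ceil _))
    exact Real.exp_le_exp.2
      (mul_le_mul_of_nonneg_left (h.roundPotential_mono hN hNN₀ le_rfl) hweight)
  · obtain ⟨m, hm, hdrop⟩ := h.exists_reachable_roundPotential_le hN hle
    refine ⟨m + 1, fun hT => ?_, ?_⟩
    · have hκ : δ / 200 = Real.exp (-Real.log (200 / δ)) := by
        rw [Real.exp_neg, Real.exp_log (by positivity), inv_div]
      rw [hκ, ← Real.exp_add, Real.exp_le_exp]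
      linarith [mul_le_mul_of_nonneg_left (hdrop hT) hweight]
    · simpa only [Nat.lt_succ_iff] using hrule.measureReal_endsAt_le N m hN hle hm

end GoodSample

/-! ### The cost of the learning algorithms -/

theorem learnBeta_le : learnBeta ≤ 86 := by
  have hsq : (2 * √2 + 2 / 3 + 3) ^ 2 ≤ (6.4967 : ℝ) ^ 2 := by
    gcongr
    linarith [sqrt_two_lt]
  unfold learnBeta
  norm_num at hsq ⊢
  linarith

theorem mul_log_le_pow_of_le {x : ℝ} (hx : 0 < Real.log x) {j : ℕ} (hj : 18 * loglog x ≤ j) :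
    86 * Real.log x ≤ (3 / 2) ^ j := by
  have hlog86 : Real.log 86 ≤ 5 := by
    calc Real.log 86 ≤ Real.log (2 ^ 7) := Real.log_le_log (by norm_num) (by norm_num)
      _ = (7 : ℕ) * Real.log 2 := Real.log_pow 2 7
      _ ≤ 5 := by norm_num; linarith [Real.log_two_lt_d9]
  have hloglog : Real.log (Real.log x) ≤ loglog x := Real.log_le_log hx (le_max_right _ _)
  have hbase : (1 / 3 : ℝ) ≤ Real.log (3 / 2) :=
    le_trans (by norm_num) (Real.one_sub_inv_le_log_of_pos (by norm_num))
  rw [← Real.log_le_log_iff (by positivity) (by positivity), Real.log_pow,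
    Real.log_mul (by norm_num) hx.ne']
  calc Real.log 86 + Real.log (Real.log x) ≤ 18 * loglog x * (1 / 3) := by
        linarith [one_le_loglog x]
    _ ≤ j * Real.log (3 / 2) := by gcongr

namespace Admissible

variable {k N₀ : ℕ} {δ : ℝ}

theorem exists_switch_lt (h : Admissible k δ) : ∃ j : ℕ, (j : ℝ) ≤ 20 * loglog (k / δ) ∧
    learnBeta * (k * Real.log (k / δ)) < 4 * k * (3 / 2) ^ j := by
  have hone := one_le_loglog (k / δ)
  refine ⟨⌈18 * loglog (k / δ)⌉₊, ?_, ?_⟩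
  · linarith [Nat.ceil_lt_add_one (by linarith : 0 ≤ 18 * loglog (k / δ))]
  have hk : (0 : ℝ) < k := by exact_mod_cast h.k_pos
  have hpow := mul_log_le_pow_of_le h.log_pos (Nat.le_ceil (18 * loglog (k / δ)))
  have hpow_pos : (0 : ℝ) < (3 / 2) ^ ⌈18 * loglog (k / δ)⌉₊ := by positivity
  calc learnBeta * (k * Real.log (k / δ)) ≤ 86 * (k * Real.log (k / δ)) :=
        mul_le_mul_of_nonneg_right learnBeta_le h.mul_log_pos.le
    _ = k * (86 * Real.log (k / δ)) := by ring
    _ ≤ k * (3 / 2) ^ ⌈18 * loglog (k / δ)⌉₊ := by gcongr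
    _ < 4 * k * (3 / 2) ^ ⌈18 * loglog (k / δ)⌉₊ := by nlinarith

theorem exists_cmyRun (h : Admissible k δ) (a : ℕ → Fin k) :
    ∃ B : ℕ, 5 * k ≤ B ∧ (B : ℝ) ≤ 85 * (k * loglog (k / δ)) ∧
      ∀ p N : ℕ, (N : ℝ) ≤ learnBeta * (k * Real.log (k / δ)) → ∃ c, CMYRun a p N c ∧ c ≤ B := by
  obtain ⟨j, hj, hlt⟩ := h.exists_switch_lt
  refine ⟨4 * k * j + 5 * k, by omega, ?_, fun p N hN =>
    DistTracking.exists_cmyRun h.k_pos a j p N (hN.trans_lt hlt)⟩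
  have hk : (k : ℝ) ≤ k * loglog (k / δ) :=
    le_mul_of_one_le_right (Nat.cast_nonneg _) (one_le_loglog _)
  have hkj : (k : ℝ) * j ≤ k * (20 * loglog (k / δ)) := by gcongr
  push_cast
  linarith

theorem exists_learningRun_of_le (h : Admissible k δ)
    (hN₀ : (N₀ : ℝ) ≤ learnBeta * (k * Real.log (k / δ)))
    (learn : (Fin k → ℕ) → ℕ → RoundRule k) (a : ℕ → Fin k) :
    ∃ c : ℕ, LearningRun learnBeta δ learn a N₀ c ∧ (c : ℝ) ≤ 85 * (k * loglog (k / δ)) := by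
  obtain ⟨B, hkB, hB, hcmy⟩ := h.exists_cmyRun a
  suffices ∃ c, LearningRun learnBeta δ learn a N₀ c ∧ c ≤ B by
    obtain ⟨c, hc, hcB⟩ := this
    exact ⟨c, hc, le_trans (by exact_mod_cast hcB) hB⟩
  rcases Nat.eq_zero_or_pos N₀ with rfl | hpos
  · exact ⟨0, .alarm, Nat.zero_le _⟩
  rcases le_or_gt N₀ (4 * k) with hle | hgt
  · exact ⟨_, .direct N₀ hpos hle, by unfold directCost; omega⟩
  · obtain ⟨c, hc, hcB⟩ := hcmy 0 N₀ hN₀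
    exact ⟨c, .cmy N₀ c hgt hN₀ hc, hcB⟩

theorem four_mul_le_switch (h : Admissible k δ) :
    (4 * k : ℝ) ≤ learnBeta * (k * Real.log (k / δ)) := by
  have := mul_le_mul_of_nonneg_right le_learnBeta h.mul_log_pos.le
  linarith [h.le_mul_log, h.one_le_k]

theorem exists_learningRun_of_not_unfinished (h : Admissible k δ)
    (hN₀ : learnBeta * (k * Real.log (k / δ)) < N₀) {learn : (Fin k → ℕ) → ℕ → RoundRule k}
    {a : ℕ → Fin k} {w : ℕ} (hw : (cmyRule k N₀).EndsAt a 0 w) {Ω : Type*} [MeasurableSpace Ω]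
    {P : Measure Ω} {X : ℕ → Ω → Fin k}
    (hrule : ReliableRounds P X δ N₀ (counter a 0 w) (learn (counter a 0 w)))
    (hdone : ¬ Unfinished (learnBeta * (k * Real.log (k / δ))) (learn (counter a 0 w)) a
      (roundBound k δ N₀) w (N₀ - w)) :
    ∃ c : ℕ, LearningRun learnBeta δ learn a N₀ c ∧ (c : ℝ) ≤ 300000000000 *
      (k * loglog (N₀ / (k * Real.log (k / δ))) + k * loglog (k / δ)) := by
  obtain ⟨B, hkB, hB, hcmy⟩ := h.exists_cmyRun a
  obtain ⟨c, hc, hle⟩ := exists_frameworkRun_of_not_unfinished h.four_mul_le_switch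
    (fun N hN p => hrule.exists_endsAt N hN a p) hrule.cost_le hkB hcmy _ w (N₀ - w) hdone
  have hgt : 4 * k < N₀ := by exact_mod_cast h.four_mul_le_switch.trans_lt hN₀
  refine ⟨_, .learnRound N₀ w c hgt hN₀ hw hc, ?_⟩
  have hcost : (cmyRule k N₀).cost = 4 * k := by
    simp only [RoundRule.cost, cmyRule]
    ring
  have hle' : (c : ℝ) ≤ 4 * k * roundBound k δ N₀ + B := by exact_mod_cast hle
  have hk : (k : ℝ) ≤ k * loglog (k / δ) :=
    le_mul_of_one_le_right (Nat.cast_nonneg _) (one_le_loglog _)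
  have hr := mul_le_mul_of_nonneg_left (h.roundBound_le hN₀) (Nat.cast_nonneg (α := ℝ) k)
  have : 0 ≤ k * loglog (N₀ / (k * Real.log (k / δ))) :=
    mul_nonneg (Nat.cast_nonneg _) (by linarith [one_le_loglog (N₀ / (k * Real.log (k / δ)))])
  rw [hcost]
  push_cast
  linarith

end Admissible

section Learning

variable {k N₀ : ℕ} {δ : ℝ} {μ : Fin k → ℝ} {Ω : Type*} [MeasurableSpace Ω] {P : Measure Ω}
  [IsProbabilityMeasure P] {X : ℕ → Ω → Fin k} {learn : (Fin k → ℕ) → ℕ → RoundRule k}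

theorem IsItemStream.measureReal_exists_goodSample_unfinished_le (hX : IsItemStream P X μ)
    (hδ : 0 < δ)
    (hlearn : ∀ n, GoodSample δ N₀ μ n → ReliableRounds P X δ N₀ n (learn n)) :
    P.real {ω | ∃ w n, GoodSample δ N₀ μ n ∧ ((cmyRule k N₀).EndsAt (fun j => X j ω) 0 w ∧
      counter (fun j => X j ω) 0 w = n) ∧ Unfinished (learnBeta * (k * Real.log (k / δ)))
        (learn n) (fun j => X j ω) (roundBound k δ N₀) w (N₀ - w)} ≤ δ / 2 := by
  have hmarkov := hX.measureReal_iUnion_inter_le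
    (κ := {q : ℕ × (Fin k → ℕ) // GoodSample δ N₀ μ q.2}) (fun q => q.1.1)
    (A := fun q => {ω | (cmyRule k N₀).EndsAt (fun j => X j ω) 0 q.1.1 ∧
      counter (fun j => X j ω) 0 q.1.1 = q.1.2})
    (fun q => measurableSet_itemAlgebra_of_dependsOn (Set.finite_Ico 0 (0 + q.1.1))
      (by rw [Nat.zero_add]; exact Set.Ico_subset_Iio_self)
      (Q := fun a => (cmyRule k N₀).EndsAt a 0 q.1.1 ∧ counter a 0 q.1.1 = q.1.2)
      fun _ _ hab => congrArg₂ And ((cmyRule k N₀).dependsOn_endsAt 0 _ hab)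
        (congrArg (· = q.1.2) (dependsOn_counter 0 _ hab)))
    (fun q => measurableSet_unfinished (learnBeta * (k * Real.log (k / δ))) (learn q.1.2)
      (roundBound k δ N₀) q.1.1 (N₀ - q.1.1)) ?_ (half_pos hδ).le
    fun q => q.2.measureReal_unfinished_le hX (hlearn _ q.2) _ (Nat.sub_le _ _)
  · refine (measureReal_mono ?_).trans
      (hmarkov.trans (mul_le_of_le_one_right (half_pos hδ).le measureReal_le_one))
    rintro ω ⟨w, n, hn, hω⟩
    exact Set.mem_iUnion.2 ⟨⟨(w, n), hn⟩, hω⟩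
  · rintro ⟨⟨w, n⟩, _⟩ ⟨⟨w', n'⟩, _⟩ hne
    refine Set.disjoint_left.2 fun ω ⟨hw, hn⟩ ⟨hw', hn'⟩ => hne (Subtype.ext ?_)
    obtain rfl : w = w' := hw.unique hw'
    exact Prod.ext rfl (hn.symm.trans hn')

theorem IsItemStream.exists_undercounted_or_unfinished_or_learningRun (hX : IsItemStream P X μ)
    (h : Admissible k δ) (hN₀ : learnBeta * (k * Real.log (k / δ)) < N₀)
    (hlearn : ∀ n, GoodSample δ N₀ μ n → ReliableRounds P X δ N₀ n (learn n)) (ω : Ω) :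
    (∃ i, Undercounted (Real.log (k / δ)) N₀ μ (fun j => X j ω) i) ∨
      (∃ w n, GoodSample δ N₀ μ n ∧ ((cmyRule k N₀).EndsAt (fun j => X j ω) 0 w ∧
        counter (fun j => X j ω) 0 w = n) ∧ Unfinished (learnBeta * (k * Real.log (k / δ)))
          (learn n) (fun j => X j ω) (roundBound k δ N₀) w (N₀ - w)) ∨
      ∃ c : ℕ, LearningRun learnBeta δ learn (fun j => X j ω) N₀ c ∧ (c : ℝ) ≤ 300000000000 *
        (k * loglog (N₀ / (k * Real.log (k / δ))) + k * loglog (k / δ)) := by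
  by_cases hunder : ∃ i, Undercounted (Real.log (k / δ)) N₀ μ (fun j => X j ω) i
  · exact .inl hunder
  have hlarge : 2 * k ≤ N₀ := by
    have : (2 * k : ℝ) ≤ N₀ := by linarith [h.four_mul_le_switch, h.one_le_k]
    exact_mod_cast this
  obtain ⟨w, hw⟩ := exists_cmyRule_endsAt h.k_pos hlarge (fun j => X j ω) 0
  have hgood := goodSample_of_not_undercounted h hN₀ hX.nonneg hX.sum_eq_one hw hunder
  by_cases hdone : Unfinished (learnBeta * (k * Real.log (k / δ)))
      (learn (counter (fun j => X j ω) 0 w)) (fun j => X j ω) (roundBound k δ N₀) w (N₀ - w)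
  · exact .inr (.inl ⟨w, _, hgood, ⟨hw, rfl⟩, hdone⟩)
  · exact .inr (.inr (h.exists_learningRun_of_not_unfinished hN₀ hw (hlearn _ hgood) hdone))

theorem IsItemStream.le_measureReal_learningRun (hX : IsItemStream P X μ) (h : Admissible k δ)
    (hlearn : ∀ n, GoodSample δ N₀ μ n → ReliableRounds P X δ N₀ n (learn n)) :
    1 - δ ≤ P.real {ω | ∃ c : ℕ, LearningRun learnBeta δ learn (fun j => X j ω) N₀ c ∧
      (c : ℝ) ≤ 300000000000 *
        (k * loglog (N₀ / (k * Real.log (k / δ))) + k * loglog (k / δ))} := by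
  set S := {ω | ∃ c : ℕ, LearningRun learnBeta δ learn (fun j => X j ω) N₀ c ∧
    (c : ℝ) ≤ 300000000000 *
      (k * loglog (N₀ / (k * Real.log (k / δ))) + k * loglog (k / δ))}
  rcases le_or_gt (N₀ : ℝ) (learnBeta * (k * Real.log (k / δ))) with hN₀ | hN₀
  · have hS : S = Set.univ := Set.eq_univ_of_forall fun ω => by
      obtain ⟨c, hc, hle⟩ := h.exists_learningRun_of_le hN₀ learn fun j => X j ω
      have hloglog (x : ℝ) : 0 ≤ k * loglog x :=
        mul_nonneg (Nat.cast_nonneg _) (by linarith [one_le_loglog x])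
      exact ⟨c, hc, by linarith [hloglog (k / δ), hloglog (N₀ / (k * Real.log (k / δ)))]⟩
    rw [hS, probReal_univ]
    linarith [h.pos]
  have hunder := hX.measureReal_exists_undercounted_le h N₀
  have hunfinished := hX.measureReal_exists_goodSample_unfinished_le h.pos hlearn
  have hcover : (1 : ℝ) ≤ δ / 2 + (δ / 2 + P.real S) :=
    calc (1 : ℝ) = P.real Set.univ := probReal_univ.symm
      _ ≤ P.real (_ ∪ (_ ∪ S)) := measureReal_mono fun ω _ =>
        hX.exists_undercounted_or_unfinished_or_learningRun h hN₀ hlearn ω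
      _ ≤ _ := (measureReal_union_le _ _).trans
        (add_le_add_right (measureReal_union_le _ _) _)
      _ ≤ δ / 2 + (δ / 2 + P.real S) :=
        add_le_add hunder (add_le_add hunfinished le_rfl)
  linarith

theorem GoodSample.reliableRounds_learnedStaticRule {n : Fin k → ℕ} (h : GoodSample δ N₀ μ n)
    (hX : IsItemStream P X μ) : ReliableRounds P X δ N₀ n (learnedStaticRule δ n) where
  cost_le N := by
    have := h.k_pos
    simp only [RoundRule.cost, learnedStaticRule, staticRule]
    omega
  exists_endsAt N _ a p := exists_staticRule_endsAt h.k_pos _ a p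
  measureReal_endsAt_le _ _ hN hNN₀ hm p :=
    h.measureReal_learnedStaticRule_endsAt_le hX hN hNN₀ hm p

theorem GoodSample.reliableRounds_learnedDynamicRule {n : Fin k → ℕ} (h : GoodSample δ N₀ μ n)
    (hX : IsItemStream P X μ) : ReliableRounds P X δ N₀ n (learnedDynamicRule δ n) where
  cost_le N := by
    simp only [RoundRule.cost, learnedDynamicRule, dynamicRule]
    omega
  exists_endsAt N hN a p := exists_dynamicRule_endsAt h.k_pos _ (h.floor_slack_pos hN) a p
  measureReal_endsAt_le _ _ hN hNN₀ hm p :=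
    h.measureReal_learnedDynamicRule_endsAt_le hX hN hNN₀ hm p

end Learning

end DistTracking

open MeasureTheory ProbabilityTheory DistTracking in
theorem mainTheorem4 :
    ∃ C : ℝ, 0 < C ∧
      ∀ (k N : ℕ) (δ : ℝ) (μ : Fin k → ℝ)
        (Ω : Type*) [MeasurableSpace Ω] (P : Measure Ω) [IsProbabilityMeasure P]
        (X : ℕ → Ω → Fin k),
        0 < δ → δ < 1 → 2 ≤ (k : ℝ) / δ →
        (∀ j, Measurable (X j)) → iIndepFun X P →
        (∀ j i, P.real {ω | X j ω = i} = μ i) →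
        1 - δ ≤ P.real {ω | ∃ c : ℕ, StcSlkLrnDst δ (fun j => X j ω) N c ∧
            (c : ℝ) ≤ C * (k * loglog (N / (k * Real.log (k / δ))) + k * loglog (k / δ))} ∧
        1 - δ ≤ P.real {ω | ∃ c : ℕ, DynSlkLrnDst δ (fun j => X j ω) N c ∧
            (c : ℝ) ≤ C * (k * loglog (N / (k * Real.log (k / δ))) + k * loglog (k / δ))} := by
  refine ⟨300000000000, by norm_num, fun k N δ μ Ω _ P _ X hδ hδ1 hk hmeas hind hlaw => ?_⟩
  have hX : IsItemStream P X μ := ⟨hmeas, hind, hlaw⟩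
  have h : Admissible k δ := ⟨hδ, hδ1, hk⟩
  exact ⟨hX.le_measureReal_learningRun h fun n hn => hn.reliableRounds_learnedStaticRule hX,
    hX.le_measureReal_learningRun h fun n hn => hn.reliableRounds_learnedDynamicRule hX⟩
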